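/- **Theorem.** The dynamic problem $\mathrm{Member}(D_1)$ can be maintained in $\mathsf{DynFO}$ with $O((\log n)^3)$ work per change and query operation. *The problem.* $D_1$ is the language of well-balanced words over $\{\langle,\rangle\}$ (including the empty word). An instance of $\mathrm{Member}(D_1)$ of size $n\ge 1$ is a sequence $w=w_0\dots w_{n-1}$ with $w_i\in\{\langle,\rangle,\varepsilon\}$, initially $w_i=\varepsilon$ for all $i$. The change operations are $\mathrm{set}_\sigma(i)$ for $\sigma\in\{\langle,\rangle\}$ (sets $w_i$ to $\sigma$ if $w_i=\varepsilon$, otherwise has no effect) and $\mathrm{reset}(i)$ (sets $w_i$ to $\varepsilon$). The Boolean query operation asks whether $w_0\circ\dots\circ w_{n-1}\in D_1$. *Dynamic programs.* A dynamic program stores an auxiliary structure over a fixed finite schema of relation and (partial) function symbols, with domain $\{0,\dots,n-1\}$. The initial auxiliary structure is defined by first-order formulas over $(\le,+,\times)$ that do not depend on $n$. Terms and conditions are built as follows. Terms: variables, the undefined value $\bot$, $t+t'$ and $t\times t'$ (equal to $\bot$ outside the domain), $f(\bar t)$ for auxiliary functions $f$, "if $C$ then $t$ else $t'$", and "the unique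 $z\le g(n)$ with $C$" (which must exist uniquely whenever it is evaluated). Conditions: $t=t'$, $t\le t'$, $R(\bar t)$ for auxiliary relations $R$, Boolean combinations, and $\exists z\le g(n)\,C$. Here each bound $g:\mathbb N\to\mathbb N$ is first-order definable, i.e. one formula over $(\le,+,\times)$ defines $\{z<n: z\le g(n)\}$ in $\{0,\dots,n-1\}$ for all $n$. For each change operation $\delta(\bar p)$ and each auxiliary symbol $S$ there is one update rule: for all $\bar x$ with $x_1\le g_1(n),\dots,x_v\le g_v(n)$, the status (for relations) or the value (for functions) of $S$ at $(t_1(\bar p;\bar x),\dots,t_m(\bar p;\bar x))$ is replaced by that of $B(\bar p;\bar x)$, where $B$ is a condition or a term, respectively; $S$ is unchanged at all other tuples. A relation holds at an updated tuple iff $B$ is true for some $\bar x$ addressing it; for functions, any two $\bar x$ addressing the same tuple must give the same value. All rules are evaluated on the old auxiliary structure. Each query operation is answered by a condition over the auxiliary structure. The program maintains the problem if, for every $n\ge1$ and every sequence of change operations applied to the initial instance, the above requirements are met and all queries are answered correctly. *Work.* Every occurrence of a symbol in a term or condition counts $1$; the work of an expression is $1$ plus the sum of the works of its immediate subexpressions,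 where for $\exists z\le g(n)\,C$ and "the unique $z\le g(n)$ with $C$" the work of $C$ is multiplied by the number $g(n)+1$ of values of $z$. The work of an update rule is $\prod_i(g_i(n)+1)\cdot\bigl(1+\sum_j \mathrm{work}(t_j)+\mathrm{work}(B)\bigr)$; the work of a change operation is the sum of the works of its update rules, and the work of a query operation is the work of its condition. *Claim.* There is a dynamic program that maintains $\mathrm{Member}(D_1)$ and for which the work of each change operation and of the query operation is $O((\log n)^3)$ as $n\to\infty$. -/

import Mathlib

namespace DynFO

/-! ### First-order logic over the domain `{0, …, n-1}` with order, addition and multiplication -/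

/-- The arithmetic relation symbols: the order `x ≤ y` and the graphs `x + y = z`, `x * y = z`. -/
inductive ArithRel : ℕ → Type
  | le : ArithRel 2
  | add : ArithRel 3
  | mul : ArithRel 3

/-- The relational first-order language of `≤`, `+`, `×` (equality is built into the logic). -/
abbrev arith : FirstOrder.Language := ⟨fun _ => Empty, ArithRel⟩

/-- The standard interpretation on `{0, …, n-1}`. -/
instance arithStructure (n : ℕ) : arith.Structure (Fin n) where
  funMap := fun f => nomatch f
  RelMap := fun {_} r => match r with
    | ArithRel.le => fun v => (v 0 : ℕ) ≤ v 1
    | ArithRel.add => fun v => (v 0 : ℕ) + v 1 = v 2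
    | ArithRel.mul => fun v => (v 0 : ℕ) * v 1 = v 2

/-- A function `g : ℕ → ℕ` that may be used as a bound `z ≤ g(n)`: one single first-order formula
over `≤, +, ×` defines, in the domain `{0, …, n-1}` for every `n`, the elements `z ≤ g(n)`. -/
structure FOBound where
  toFun : ℕ → ℕ
  definable : ∃ φ : arith.Formula (Fin 1), ∀ (n : ℕ) (z : Fin n),
    φ.Realize (fun _ => z) ↔ (z : ℕ) ≤ toFun n

/-! ### Schemas and structures -/

/-- A finite schema: relation symbols and function symbols with arities. -/
structure Schema where
  Rel : Type
  Func : Type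
  relFintype : Fintype Rel
  funcFintype : Fintype Func
  relArity : Rel → ℕ
  funcArity : Func → ℕ

attribute [instance] Schema.relFintype Schema.funcFintype

/-- A structure over the schema `τ` with domain `{0, …, n-1}`; functions may be partial, the value
`none` stands for "undefined". -/
structure Str (τ : Schema) (n : ℕ) where
  rel : (R : τ.Rel) → (Fin (τ.relArity R) → Fin n) → Prop
  func : (f : τ.Func) → (Fin (τ.funcArity f) → Fin n) → Option (Fin n)

/-! ### Terms and conditions -/

mutual

/-- Terms over the schema `τ` with free variables indexed by `Fin k`. A binder introduces
the variable with the last index. -/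
inductive Term (τ : Schema) : ℕ → Type
  | var {k : ℕ} (i : Fin k) : Term τ k
  | undef {k : ℕ} : Term τ k
  | add {k : ℕ} (s t : Term τ k) : Term τ k
  | mul {k : ℕ} (s t : Term τ k) : Term τ k
  | app {k : ℕ} (f : τ.Func) (ts : Fin (τ.funcArity f) → Term τ k) : Term τ k
  | ite {k : ℕ} (c : Cond τ k) (s t : Term τ k) : Term τ k
  | unique {k : ℕ} (g : FOBound) (c : Cond τ (k + 1)) : Term τ k

/-- Conditions over the schema `τ` with free variables indexed by `Fin k`. -/
inductive Cond (τ : Schema) : ℕ → Type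
  | eq {k : ℕ} (s t : Term τ k) : Cond τ k
  | le {k : ℕ} (s t : Term τ k) : Cond τ k
  | rel {k : ℕ} (R : τ.Rel) (ts : Fin (τ.relArity R) → Term τ k) : Cond τ k
  | not {k : ℕ} (c : Cond τ k) : Cond τ k
  | and {k : ℕ} (c d : Cond τ k) : Cond τ k
  | or {k : ℕ} (c d : Cond τ k) : Cond τ k
  | ex {k : ℕ} (g : FOBound) (c : Cond τ (k + 1)) : Cond τ k

end

/-- The element `m` of `{0, …, n-1}`, undefined if `m ≥ n`. -/
def ofNat? (n m : ℕ) : Option (Fin n) := if h : m < n then some ⟨m, h⟩ else none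

open Classical in
/-- The tuple of the values of `v` if all of them are defined, otherwise undefined. -/
noncomputable def tuple? {ι α : Type} (v : ι → Option α) : Option (ι → α) :=
  if h : ∃ a : ι → α, ∀ i, v i = some (a i) then some h.choose else none

open Classical in
/-- The unique element with property `p`, undefined if there is no such element. -/
noncomputable def the? {α : Type} (p : α → Prop) : Option α :=
  if h : ∃! a, p a then some h.choose else none

/-- The environment `e` extended by the value `a` of a new last variable. -/
def extend {n k : ℕ} (e : Fin k → Fin n) (a : Fin n) : Fin (k + 1) → Fin n :=
  Fin.snoc (α := fun _ => Fin n) e a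

section Semantics

variable {τ : Schema} {n : ℕ}

open Classical in
mutual

/-- The value of a term (possibly undefined) in a structure under an assignment. -/
noncomputable def Term.eval (A : Str τ n) :
    {k : ℕ} → Term τ k → (Fin k → Fin n) → Option (Fin n)
  | _, .var i, e => some (e i)
  | _, .undef, _ => none
  | _, .add s t, e => (s.eval A e).bind fun a => (t.eval A e).bind fun b => ofNat? n (a + b)
  | _, .mul s t, e => (s.eval A e).bind fun a => (t.eval A e).bind fun b => ofNat? n (a * b)
  | _, .app f ts, e => (tuple? fun i => (ts i).eval A e).bind (A.func f)
  | _, .ite c s t, e => if c.Holds A e then s.eval A e else t.eval A e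
  | _, .unique g c, e => the? fun a : Fin n => (a : ℕ) ≤ g.toFun n ∧ c.Holds A (extend e a)

/-- The truth value of a condition. Equality compares values, where "undefined" is equal only to
itself; the other atomic conditions are false if an argument is undefined. -/
noncomputable def Cond.Holds (A : Str τ n) : {k : ℕ} → Cond τ k → (Fin k → Fin n) → Prop
  | _, .eq s t, e => s.eval A e = t.eval A e
  | _, .le s t, e => ∃ a b, s.eval A e = some a ∧ t.eval A e = some b ∧ a ≤ b
  | _, .rel R ts, e => ∃ a, (∀ i, (ts i).eval A e = some (a i)) ∧ A.rel R a
  | _, .not c, e => ¬ c.Holds A e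
  | _, .and c d, e => c.Holds A e ∧ d.Holds A e
  | _, .or c d, e => c.Holds A e ∨ d.Holds A e
  | _, .ex g c, e => ∃ a : Fin n, (a : ℕ) ≤ g.toFun n ∧ c.Holds A (extend e a)

end

mutual

/-- In the evaluation of the term, every expression `unique z ≤ g(n) (c)` that is evaluated has
exactly one witness. -/
def Term.Safe (A : Str τ n) : {k : ℕ} → Term τ k → (Fin k → Fin n) → Prop
  | _, .var _, _ => True
  | _, .undef, _ => True
  | _, .add s t, e => s.Safe A e ∧ t.Safe A e
  | _, .mul s t, e => s.Safe A e ∧ t.Safe A e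
  | _, .app _ ts, e => ∀ i, (ts i).Safe A e
  | _, .ite c s t, e => c.Safe A e ∧ (c.Holds A e → s.Safe A e) ∧ (¬ c.Holds A e → t.Safe A e)
  | _, .unique g c, e => (∀ a : Fin n, (a : ℕ) ≤ g.toFun n → c.Safe A (extend e a)) ∧
      ∃! a : Fin n, (a : ℕ) ≤ g.toFun n ∧ c.Holds A (extend e a)

/-- The same requirement for conditions. -/
def Cond.Safe (A : Str τ n) : {k : ℕ} → Cond τ k → (Fin k → Fin n) → Prop
  | _, .eq s t, e => s.Safe A e ∧ t.Safe A e
  | _, .le s t, e => s.Safe A e ∧ t.Safe A e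
  | _, .rel _ ts, e => ∀ i, (ts i).Safe A e
  | _, .not c, e => c.Safe A e
  | _, .and c d, e => c.Safe A e ∧ d.Safe A e
  | _, .or c d, e => c.Safe A e ∧ d.Safe A e
  | _, .ex g c, e => ∀ a : Fin n, (a : ℕ) ≤ g.toFun n → c.Safe A (extend e a)

end

end Semantics

/-! ### Work: every symbol occurrence costs one step, and a bounded search over `z ≤ g(n)` is
carried out in parallel for all `g(n) + 1` values of `z` -/

mutual

/-- The work for evaluating a term over a domain of size `n`. -/
def Term.work {τ : Schema} (n : ℕ) : {k : ℕ} → Term τ k → ℕ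
  | _, .var _ => 1
  | _, .undef => 1
  | _, .add s t => 1 + s.work n + t.work n
  | _, .mul s t => 1 + s.work n + t.work n
  | _, .app _ ts => 1 + ∑ i, (ts i).work n
  | _, .ite c s t => 1 + c.work n + s.work n + t.work n
  | _, .unique g c => 1 + (g.toFun n + 1) * c.work n

/-- The work for evaluating a condition over a domain of size `n`. -/
def Cond.work {τ : Schema} (n : ℕ) : {k : ℕ} → Cond τ k → ℕ
  | _, .eq s t => 1 + s.work n + t.work n
  | _, .le s t => 1 + s.work n + t.work n
  | _, .rel _ ts => 1 + ∑ i, (ts i).work n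
  | _, .not c => 1 + c.work n
  | _, .and c d => 1 + c.work n + d.work n
  | _, .or c d => 1 + c.work n + d.work n
  | _, .ex g c => 1 + (g.toFun n + 1) * c.work n

end

/-! ### Update rules -/

/-- An update rule "on change `δ(p₁,…,p_a)` update the `m`-ary symbol at `(t₁(p;x),…,t_m(p;x))`,
for all `x` with `x₁ ≤ g₁(n), …, x_v ≤ g_v(n)`, by `body(p;x)`". The variables of the terms and of
the body are `p₁,…,p_a,x₁,…,x_v` in this order. The body is a condition if the symbol is a relation
symbol, and a term if it is a function symbol. -/
structure UpdateRule (τ : Schema) (a m : ℕ) (Body : ℕ → Type) where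
  vars : ℕ
  bound : Fin vars → FOBound
  target : Fin m → Term τ (a + vars)
  body : Body (a + vars)

namespace UpdateRule

variable {τ : Schema} {a m n : ℕ} {Body : ℕ → Type}

/-- The tuple `x` satisfies the constraint of the rule. -/
def Constraint (π : UpdateRule τ a m Body) (x : Fin π.vars → Fin n) : Prop :=
  ∀ i, (x i : ℕ) ≤ (π.bound i).toFun n

/-- With parameters `p`, the tuple `x` satisfies the constraint and addresses the tuple `b`. -/
def Addresses (π : UpdateRule τ a m Body) (A : Str τ n) (p : Fin a → Fin n)
    (x : Fin π.vars → Fin n) (b : Fin m → Fin n) : Prop :=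
  π.Constraint x ∧ ∀ i, (π.target i).eval A (Fin.append p x) = some (b i)

/-- The new relation: addressed tuples are in it iff the body is true for some tuple `x` addressing
them, all other tuples keep their status (given by `old`). -/
def newRel (π : UpdateRule τ a m (Cond τ)) (A : Str τ n) (p : Fin a → Fin n)
    (old : (Fin m → Fin n) → Prop) (b : Fin m → Fin n) : Prop :=
  (old b ∧ ¬ ∃ x, π.Addresses A p x b) ∨
    ∃ x, π.Addresses A p x b ∧ π.body.Holds A (Fin.append p x)

open Classical in
/-- The new function: at addressed tuples it has the value of the body, at all other tuples it keeps
its value (given by `old`). The choice of `x` is irrelevant for safe rules, see `FuncSafe`. -/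
noncomputable def newFunc (π : UpdateRule τ a m (Term τ)) (A : Str τ n) (p : Fin a → Fin n)
    (old : (Fin m → Fin n) → Option (Fin n)) (b : Fin m → Fin n) : Option (Fin n) :=
  if h : ∃ x, π.Addresses A p x b then π.body.eval A (Fin.append p h.choose) else old b

/-- All evaluations made by the rule are safe. -/
def RelSafe (π : UpdateRule τ a m (Cond τ)) (A : Str τ n) (p : Fin a → Fin n) : Prop :=
  ∀ x, π.Constraint x →
    (∀ i, (π.target i).Safe A (Fin.append p x)) ∧ π.body.Safe A (Fin.append p x)

/-- All evaluations made by the rule are safe, and no two tuples `x`, `y` give different new values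
to the same function argument. -/
def FuncSafe (π : UpdateRule τ a m (Term τ)) (A : Str τ n) (p : Fin a → Fin n) : Prop :=
  (∀ x, π.Constraint x →
    (∀ i, (π.target i).Safe A (Fin.append p x)) ∧ π.body.Safe A (Fin.append p x)) ∧
  ∀ x y b, π.Addresses A p x b → π.Addresses A p y b →
    π.body.eval A (Fin.append p x) = π.body.eval A (Fin.append p y)

/-- The work of a rule: targets and body are evaluated for all tuples satisfying the constraint. -/
def work (bodyWork : ℕ) (π : UpdateRule τ a m Body) (n : ℕ) : ℕ :=
  (∏ i, ((π.bound i).toFun n + 1)) * (1 + (∑ i, (π.target i).work n) + bodyWork)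

end UpdateRule

/-! ### Dynamic problems and dynamic programs -/

/-- A dynamic problem (with relational queries): for every domain `{0, …, n-1}` a set of states with
an initial state, change operations and query operations, both with parameters from the domain. -/
structure DynProblem where
  State : ℕ → Type
  init : (n : ℕ) → State n
  Change : Type
  changeArity : Change → ℕ
  change : {n : ℕ} → (δ : Change) → (Fin (changeArity δ) → Fin n) → State n → State n
  Query : Type
  queryArity : Query → ℕ
  answer : {n : ℕ} → (q : Query) → (Fin (queryArity q) → Fin n) → State n → Prop

/-- A change operation of `Q` with actual parameters from `{0, …, n-1}`. -/
abbrev ChangeInst (Q : DynProblem) (n : ℕ) : Type :=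
  Σ δ : Q.Change, Fin (Q.changeArity δ) → Fin n

/-- The state of the problem after a sequence of changes, starting from the initial state. -/
def DynProblem.run (Q : DynProblem) (n : ℕ) (α : List (ChangeInst Q n)) : Q.State n :=
  α.foldl (fun s c => Q.change c.1 c.2 s) (Q.init n)

/-- A dynamic program for `Q`: an auxiliary schema, first-order formulas over `≤, +, ×` defining
the initial auxiliary structure, one update rule for every change operation and every
auxiliary symbol, and one query rule for every query operation. In `initFunc f`, the variables `inl i`
stand for the arguments and `inr ()` stands for the function value. -/
structure DynProgram (Q : DynProblem) where
  schema : Schema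
  initRel : (R : schema.Rel) → arith.Formula (Fin (schema.relArity R))
  initFunc : (f : schema.Func) → arith.Formula (Fin (schema.funcArity f) ⊕ Unit)
  updateRel : (δ : Q.Change) → (R : schema.Rel) →
    UpdateRule schema (Q.changeArity δ) (schema.relArity R) (Cond schema)
  updateFunc : (δ : Q.Change) → (f : schema.Func) →
    UpdateRule schema (Q.changeArity δ) (schema.funcArity f) (Term schema)
  query : (q : Q.Query) → Cond schema (Q.queryArity q)

namespace DynProgram

variable {Q : DynProblem}

/-- The initial auxiliary structure. -/
noncomputable def initStr (P : DynProgram Q) (n : ℕ) : Str P.schema n where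
  rel R v := (P.initRel R).Realize v
  func f v := the? fun b : Fin n => (P.initFunc f).Realize (Sum.elim v fun _ => b)

/-- The auxiliary structure after a change operation; all rules are evaluated on the old one. -/
noncomputable def step (P : DynProgram Q) {n : ℕ} (c : ChangeInst Q n) (A : Str P.schema n) :
    Str P.schema n where
  rel R := (P.updateRel c.1 R).newRel A c.2 (A.rel R)
  func f := (P.updateFunc c.1 f).newFunc A c.2 (A.func f)

/-- The auxiliary structure after a sequence of changes, starting from the initial one. -/
noncomputable def run (P : DynProgram Q) (n : ℕ) (α : List (ChangeInst Q n)) : Str P.schema n :=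
  α.foldl (fun A c => P.step c A) (P.initStr n)

/-- `P` is a dynamic program for `Q`: over every nonempty domain and after every sequence of
changes, all rules are well defined and all queries are answered correctly. -/
def Maintains (P : DynProgram Q) : Prop :=
  ∀ n : ℕ, 0 < n → ∀ α : List (ChangeInst Q n),
    (∀ (c : ChangeInst Q n),
      (∀ R, (P.updateRel c.1 R).RelSafe (P.run n α) c.2) ∧
      (∀ f, (P.updateFunc c.1 f).FuncSafe (P.run n α) c.2)) ∧
    (∀ (q : Q.Query) (b : Fin (Q.queryArity q) → Fin n),
      (P.query q).Safe (P.run n α) b ∧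
      ((P.query q).Holds (P.run n α) b ↔ Q.answer q b (Q.run n α)))

/-- The work for a change operation `δ` over a domain of size `n`: the total work of all rules. -/
def changeWork (P : DynProgram Q) (δ : Q.Change) (n : ℕ) : ℕ :=
  (∑ R, (P.updateRel δ R).work ((P.updateRel δ R).body.work n) n) +
    ∑ f, (P.updateFunc δ f).work ((P.updateFunc δ f).body.work n) n

/-- The work for a query operation `q` over a domain of size `n`. -/
def queryWork (P : DynProgram Q) (q : Q.Query) (n : ℕ) : ℕ := (P.query q).work n

end DynProgram

/-! ### The membership problem of a language -/

/-- The change operations for words: `set σ` writes the letter `σ` at a position that carries no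
letter, `reset` deletes the letter at a position. -/
inductive WordChange (α : Type) : Type
  | set (σ : α)
  | reset

open Classical in
/-- The dynamic problem `Member(L)`: maintain `w₀ … w_{n-1}` with `w_i ∈ Σ ∪ {ε}` (`none` is `ε`),
initially `ε` everywhere; the only, Boolean, query asks if `w₀ ∘ … ∘ w_{n-1} ∈ L`. -/
noncomputable def memberProblem {α : Type} (L : Language α) : DynProblem where
  State n := Fin n → Option α
  init _ := fun _ => none
  Change := WordChange α
  changeArity _ := 1
  change δ i w := match δ with
    | .set σ => if w (i 0) = none then Function.update w (i 0) (some σ) else w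
    | .reset => Function.update w (i 0) none
  Query := Unit
  queryArity _ := 0
  answer _ _ w := (List.ofFn w).reduceOption ∈ L

/-- The Dyck language with one type of parentheses; `DyckStep.U` is the opening and `DyckStep.D` the
closing parenthesis. -/
def dyckLanguage : Language DyckStep := {w | ∃ d : DyckWord, d.toList = w}

end DynFO

-- Let h(q) be the number of opening minus the number of closing parentheses at the positions 0, …,
-- q. The word is well-balanced iff h(n-1) is the minimum of h and this minimum is 0. A change at p
-- adds one of -1, 0, 1 to h at all q ≥ p, so h itself is too expensive to maintain; only
-- differences inside blocks are stored.
--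
-- The domain is cut into a hierarchy of blocks, where level z has length lcm(1, …, z+1). Each
-- length divides the next with quotient at most z+2, and lcm(1, …, z+1) ≥ 2^(z+1)/(z+2), so the
-- number of levels and the branching are both O(log n). Being a least positive common multiple, the
-- length is expressible by divisibility, so block starts and children are first-order definable and
-- can be provided by the initial structure.
--
-- For the block of level z starting at a, its depth h(a) - min h is stored. For each block start c
-- of level z below the top, with a the start of the surrounding block of level z+1, the number of
-- letters of each kind in (a, c] is stored. A change at p touches the depth of one block per level
-- and the counts at the children of the blocks around p. If p lies in a block but is not its start,
-- h(a) is unaffected; the depth then depends only on whether the old minimum is attained before p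
-- (when h rises) or from p on (when h drops).
--
-- This is decided by `exists_mem_eq_blockMin_iff`: the relevant side of p is made up of subblocks
-- on or branching off the path from p up to the block, and the minimum is attained there iff one of
-- them has the same minimum as its parent and no later step up the path lowers the minimum. By
-- `blockMin_eq_iff_count`, each equality of minima is a comparison of sums of stored numbers, all
-- below n by `count_add_depth_lt`.
--
-- A test searches the levels and, inside that, the children and the path, so it costs O((log n)²);
-- one depth per level gives O((log n)³). The O((log n)²) affected counts cost O(1) each, and the
-- query follows the single path from n-1 upwards.

namespace DynFO

/-! ### First-order definable families of relations -/

/-- A family of relations, one on each domain `{0, …, n-1}`, defined by a single formula over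
`≤, +, ×`. -/
def Definable {ι : Type} (R : ∀ n : ℕ, (ι → Fin n) → Prop) : Prop :=
  ∃ φ : arith.Formula ι, ∀ (n : ℕ) (v : ι → Fin n), φ.Realize v ↔ R n v

namespace Definable

variable {ι : Type}

theorem le (i j : ι) : Definable fun _ v => (v i : ℕ) ≤ v j := by
  refine ⟨FirstOrder.Language.Relations.formula (L := arith) ArithRel.le
    ![.var i, .var j], fun n v => ?_⟩
  rw [FirstOrder.Language.Formula.realize_rel]
  exact Iff.rfl

theorem add (i j k : ι) : Definable fun _ v => (v i : ℕ) + v j = v k := by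
  refine ⟨FirstOrder.Language.Relations.formula (L := arith) ArithRel.add
    ![.var i, .var j, .var k], fun n v => ?_⟩
  rw [FirstOrder.Language.Formula.realize_rel]
  exact Iff.rfl

theorem mul (i j k : ι) : Definable fun _ v => (v i : ℕ) * v j = v k := by
  refine ⟨FirstOrder.Language.Relations.formula (L := arith) ArithRel.mul
    ![.var i, .var j, .var k], fun n v => ?_⟩
  rw [FirstOrder.Language.Formula.realize_rel]
  exact Iff.rfl

variable {R S : ∀ n : ℕ, (ι → Fin n) → Prop}

theorem congr (h : Definable R) (hRS : ∀ n v, S n v ↔ R n v) : Definable S := by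
  obtain ⟨φ, hφ⟩ := h
  exact ⟨φ, fun n v => (hφ n v).trans (hRS n v).symm⟩

theorem not (h : Definable R) : Definable fun n v => ¬ R n v := by
  obtain ⟨φ, hφ⟩ := h
  exact ⟨φ.not, fun n v => by rw [FirstOrder.Language.Formula.realize_not, hφ]⟩

theorem and (h : Definable R) (h' : Definable S) : Definable fun n v => R n v ∧ S n v := by
  obtain ⟨φ, hφ⟩ := h
  obtain ⟨ψ, hψ⟩ := h'
  exact ⟨φ ⊓ ψ, fun n v => by rw [FirstOrder.Language.Formula.realize_inf, hφ, hψ]⟩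

theorem or (h : Definable R) (h' : Definable S) : Definable fun n v => R n v ∨ S n v :=
  ((h.not.and h'.not).not).congr fun _ _ => by tauto

theorem imp (h : Definable R) (h' : Definable S) : Definable fun n v => R n v → S n v :=
  (h.not.or h').congr fun _ _ => by tauto

theorem ex {R : ∀ n : ℕ, (ι → Fin n) → Fin n → Prop}
    (h : Definable (ι := ι ⊕ Unit) fun n v => R n (fun i => v (.inl i)) (v (.inr ()))) :
    Definable fun n v => ∃ a, R n v a := by
  obtain ⟨φ, hφ⟩ := h
  refine ⟨φ.iExs Unit, fun n v => ?_⟩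
  rw [FirstOrder.Language.Formula.realize_iExs]
  constructor
  · rintro ⟨i, hi⟩
    exact ⟨i (), (hφ n _).1 hi⟩
  · rintro ⟨a, ha⟩
    exact ⟨fun _ => a, (hφ n _).2 ha⟩

theorem all {R : ∀ n : ℕ, (ι → Fin n) → Fin n → Prop}
    (h : Definable (ι := ι ⊕ Unit) fun n v => R n (fun i => v (.inl i)) (v (.inr ()))) :
    Definable fun n v => ∀ a, R n v a :=
  (ex (R := fun n v a => ¬ R n v a) h.not).not.congr fun _ _ => by simp

theorem lt (i j : ι) : Definable fun _ v => (v i : ℕ) < v j :=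
  (le j i).not.congr fun _ _ => by simp

theorem zero (i : ι) : Definable fun _ v => (v i : ℕ) = 0 := by
  refine (all (R := fun n v a => (v i : ℕ) ≤ a) (le _ _)).congr fun n v => ⟨?_, ?_⟩
  · intro h a
    omega
  · intro h
    simpa using h ⟨0, (Nat.zero_le _).trans_lt (v i).2⟩

theorem succ (i j : ι) : Definable fun _ v => (v i : ℕ) + 1 = v j := by
  refine ((lt i j).and (all (R := fun n v a => (v i : ℕ) < a → (v j : ℕ) ≤ a)
    ((lt _ _).imp (le _ _)))).congr fun n v => ⟨?_, ?_⟩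
  · intro h
    exact ⟨by omega, fun a ha => by omega⟩
  · rintro ⟨h₁, h₂⟩
    have := h₂ ⟨v i + 1, lt_of_le_of_lt h₁ (v j).2⟩ (by simp)
    simp only at this
    omega

theorem dvd (i j : ι) : Definable fun _ v => (v i : ℕ) ∣ v j := by
  refine (ex (R := fun n v a => (v i : ℕ) * a = v j) (mul _ _ _)).congr fun n v => ⟨?_, ?_⟩
  · rintro ⟨k, hk⟩
    -- For divisor 0 the cofactor `k` may lie outside the domain, but then `v j = 0` and 0 itself
    -- serves.
    rcases Nat.eq_zero_or_pos (v i : ℕ) with h0 | h0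
    · exact ⟨v i, by rw [hk, h0]; simp⟩
    · refine ⟨⟨k, lt_of_le_of_lt ?_ (v j).2⟩, hk.symm⟩
      rw [hk]
      exact Nat.le_mul_of_pos_left k h0
  · rintro ⟨a, ha⟩
    exact ⟨a, ha.symm⟩

end Definable

/-! ### Block lengths -/

/-- The length of the blocks of level `z`: the least common multiple of `1, …, z + 1`. -/
def blockLen (z : ℕ) : ℕ := Nat.lcmUpto (z + 1)

theorem blockLen_pos (z : ℕ) : 0 < blockLen z := Nat.lcmUpto_pos _

theorem blockLen_dvd_iff (z l : ℕ) :
    blockLen z ∣ l ↔ ∀ i, 0 < i → i ≤ z + 1 → i ∣ l := by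
  simp only [blockLen, Nat.lcmUpto, Finset.lcm_dvd_iff, Finset.mem_Icc, id]
  exact ⟨fun h i h₁ h₂ => h i ⟨h₁, h₂⟩, fun h i hi => h i hi.1 hi.2⟩

theorem dvd_blockLen {z i : ℕ} (h₀ : 0 < i) (h : i ≤ z + 1) : i ∣ blockLen z :=
  (blockLen_dvd_iff z _).1 dvd_rfl i h₀ h

theorem lt_blockLen (z : ℕ) : z < blockLen z :=
  Nat.le_of_dvd (blockLen_pos z) (dvd_blockLen z.succ_pos le_rfl)

@[simp] theorem blockLen_zero : blockLen 0 = 1 := by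
  have := (blockLen_dvd_iff 0 1).2 fun i h₁ h₂ => by
    obtain rfl : i = 1 := by omega
    exact dvd_rfl
  exact Nat.dvd_one.1 this

theorem blockLen_dvd_succ (z : ℕ) : blockLen z ∣ blockLen (z + 1) :=
  (blockLen_dvd_iff _ _).2 fun _ h₁ h₂ => dvd_blockLen h₁ (by omega)

theorem blockLen_mono : Monotone blockLen :=
  monotone_nat_of_le_succ fun z => Nat.le_of_dvd (blockLen_pos _) (blockLen_dvd_succ z)

/-- (z + 2) · `blockLen z` is a common multiple of 1, …, z + 2. This bounds the number of children
of a block. -/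
theorem blockLen_succ_le (z : ℕ) : blockLen (z + 1) ≤ (z + 2) * blockLen z := by
  refine Nat.le_of_dvd (Nat.mul_pos (by omega) (blockLen_pos z))
    ((blockLen_dvd_iff _ _).2 fun i h₁ h₂ => ?_)
  rcases Nat.lt_or_ge i (z + 2) with h | h
  · exact (dvd_blockLen h₁ (by omega)).mul_left _
  · obtain rfl : i = z + 2 := by omega
    exact dvd_mul_right _ _

/-- The form that can be turned into a formula: leastness among positive common multiples, in terms
of divisibility only. -/
theorem blockLen_eq_iff (z l : ℕ) : blockLen z = l ↔
    0 < l ∧ (∀ i, 0 < i → i ≤ z + 1 → i ∣ l) ∧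
      ∀ l', l' < l → 0 < l' → ¬ ∀ i, 0 < i → i ≤ z + 1 → i ∣ l' := by
  simp only [← blockLen_dvd_iff]
  constructor
  · rintro rfl
    exact ⟨blockLen_pos z, dvd_rfl, fun l' h h₀ hd => absurd (Nat.le_of_dvd h₀ hd) (by omega)⟩
  · rintro ⟨h₀, hd, hmin⟩
    refine le_antisymm (Nat.le_of_dvd h₀ hd) ?_
    by_contra h
    exact hmin _ (not_le.1 h) (blockLen_pos z) dvd_rfl

/-- The first position of the block of level `z` that contains the position `p`. -/
def blockStart (z p : ℕ) : ℕ := p / blockLen z * blockLen z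

/-- The position `c` starts the `i`-th block of level `z` inside the block of level `z + 1` that
contains `p`. -/
def IsChild (z p i c : ℕ) : Prop :=
  c = blockStart (z + 1) p + i * blockLen z ∧ blockStart (z + 1) c = blockStart (z + 1) p

theorem exists_le_blockLen (n : ℕ) : ∃ z, n ≤ blockLen z := ⟨n, (lt_blockLen n).le⟩

/-- The lowest level with a single block. -/
def top (n : ℕ) : ℕ := Nat.find (exists_le_blockLen n)

theorem le_blockLen_top (n : ℕ) : n ≤ blockLen (top n) := Nat.find_spec (exists_le_blockLen n)

theorem blockLen_lt_iff {n z : ℕ} : blockLen z < n ↔ z < top n := by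
  constructor
  · intro h
    by_contra h'
    exact absurd ((le_blockLen_top n).trans (blockLen_mono (not_lt.1 h'))) (by omega)
  · intro h
    exact not_le.1 (Nat.find_min (exists_le_blockLen n) h)

theorem top_lt {n : ℕ} (hn : 0 < n) : top n < n := by
  have : top n ≤ n - 1 := Nat.find_min' _ (by have := lt_blockLen (n - 1); omega)
  omega

-- First-order definability of the block hierarchy

namespace Definable

variable {ι : Type}

theorem blockLen_eq (z l : ι) : Definable fun _ v => blockLen (v z) = v l := by
  have aux : ∀ {κ : Type} (y l : κ), Definable fun n v => ∀ i : Fin n, 0 < (i : ℕ) →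
      (i : ℕ) ≤ v y → (i : ℕ) ∣ v l := fun y l =>
    all (R := fun n v i => 0 < (i : ℕ) → (i : ℕ) ≤ v y → (i : ℕ) ∣ v l)
      (((zero _).not.congr fun _ _ => Nat.pos_iff_ne_zero).imp ((le _ _).imp (dvd _ _)))
  have key : Definable fun n v => ∃ y : Fin n, (v z : ℕ) + 1 = y ∧ (¬ (v l : ℕ) = 0) ∧
      (∀ i : Fin n, 0 < (i : ℕ) → (i : ℕ) ≤ y → (i : ℕ) ∣ v l) ∧
      ∀ l' : Fin n, (l' : ℕ) < v l → ¬ (l' : ℕ) = 0 →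
        ¬ ∀ i : Fin n, 0 < (i : ℕ) → (i : ℕ) ≤ y → (i : ℕ) ∣ l' := by
    refine ex ((succ _ _).and ((zero _).not.and ((aux _ _).and (all ?_))))
    exact (lt _ _).imp ((zero _).not.imp (aux _ _).not)
  refine key.congr fun n v => ?_
  constructor
  · intro h
    have hz : (v z : ℕ) + 1 < n + 1 := by
      have := lt_blockLen (v z)
      omega
    -- Since `z + 1 ≤ blockLen z < n`, the number z + 1 is a domain element that `y` can name.
    have hz' : (v z : ℕ) + 1 < n := by
      have := lt_blockLen (v z)
      omega
    obtain ⟨h₁, h₂, h₃⟩ := (blockLen_eq_iff _ _).1 h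
    refine ⟨⟨v z + 1, hz'⟩, rfl, h₁.ne', fun i => h₂ i, fun l' hl hl' hd => ?_⟩
    exact h₃ l' hl (Nat.pos_iff_ne_zero.2 hl') fun i hi hi' => hd ⟨i, by omega⟩ hi hi'
  · rintro ⟨y, hy, h₁, h₂, h₃⟩
    refine (blockLen_eq_iff _ _).2 ⟨Nat.pos_iff_ne_zero.2 h₁, fun i hi hi' => ?_, ?_⟩
    · exact h₂ ⟨i, by omega⟩ hi (by simp only; omega)
    · intro l' hl hl' hd
      exact h₃ ⟨l', by omega⟩ hl hl'.ne' fun i hi hi' => hd i hi (by omega)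

theorem blockLen_lt (z : ι) : Definable fun n v => blockLen (v z) < n :=
  (ex (R := fun _ v l => blockLen (v z) = l) (blockLen_eq _ _)).congr fun _ _ =>
    ⟨fun h => ⟨⟨_, h⟩, rfl⟩, fun ⟨l, hl⟩ => hl ▸ l.2⟩

/-- If the block length is not a domain element, the only block starts at 0. Otherwise s is the
multiple of l with s ≤ p < s + l; as s + l may leave the domain, the second inequality is expressed
by denying that some element equals s + l and is at most p. -/
theorem blockStart_eq (z p s : ι) : Definable fun _ v => blockStart (v z) (v p) = v s := by
  have key : Definable fun n v => (¬ blockLen (v z) < n ∧ (v s : ℕ) = 0) ∨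
      ∃ l : Fin n, blockLen (v z) = l ∧ (l : ℕ) ∣ v s ∧ (v s : ℕ) ≤ v p ∧
        ¬ ∃ t : Fin n, (v s : ℕ) + l = t ∧ (t : ℕ) ≤ v p := by
    refine ((blockLen_lt z).not.and (zero s)).or
      (ex ((blockLen_eq _ _).and ((dvd _ _).and ((le _ _).and (not (ex ?_))))))
    exact (add _ _ _).and (le _ _)
  refine key.congr fun n v => ?_
  have h₀ := blockLen_pos (v z)
  have hdm := Nat.div_add_mod' (v p) (blockLen (v z))
  have hmod := Nat.mod_lt (v p) h₀
  have hst : blockStart (v z) (v p) = (v p : ℕ) / blockLen (v z) * blockLen (v z) := rfl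
  constructor
  · intro h
    rcases Nat.lt_or_ge (blockLen (v z)) n with hl | hl
    · refine .inr ⟨⟨_, hl⟩, rfl, ?_, ?_, ?_⟩
      · rw [← h]
        exact dvd_mul_left _ _
      · omega
      · rintro ⟨t, ht, ht'⟩
        simp only at ht
        omega
    · refine .inl ⟨not_lt.2 hl, ?_⟩
      rw [← h, hst, Nat.div_eq_of_lt (lt_of_lt_of_le (v p).2 hl), zero_mul]
  · rintro (⟨hl, hs⟩ | ⟨l, hl, hd, hle, hno⟩)
    · rw [hs, hst, Nat.div_eq_of_lt (lt_of_lt_of_le (v p).2 (not_lt.1 hl)), zero_mul]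
    · obtain ⟨k, hk⟩ := hd
      rw [← hl] at hk hno
      have hlt : (v p : ℕ) < v s + blockLen (v z) := by
        by_contra h'
        exact hno ⟨⟨v s + blockLen (v z), by omega⟩, rfl, not_lt.1 h'⟩
      rw [hst, hk, Nat.div_eq_of_lt_le (k := k) (by rw [mul_comm, ← hk]; exact hle)
        (by rw [add_mul, mul_comm, ← hk]; omega), mul_comm]

/-- The guard `blockLen z < n` puts the level z + 1 inside the domain, so that a formula can refer
to it. -/
theorem isChild (z p i c : ι) :
    Definable fun n v => blockLen (v z) < n ∧ IsChild (v z) (v p) (v i) (v c) := by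
  have key : Definable fun n v => ∃ y : Fin n, (v z : ℕ) + 1 = y ∧ ∃ l : Fin n,
      blockLen (v z) = l ∧ ∃ t : Fin n, (v i : ℕ) * l = t ∧ ∃ s : Fin n,
        blockStart y (v p) = s ∧ blockStart y (v c) = s ∧ (s : ℕ) + t = v c := by
    refine ex ((succ _ _).and (ex ((blockLen_eq _ _).and (ex ((mul _ _ _).and (ex ?_))))))
    exact (blockStart_eq _ _ _).and ((blockStart_eq _ _ _).and (add _ _ _))
  refine key.congr fun n v => ?_
  constructor
  · rintro ⟨hl, hc, hs⟩
    have := lt_blockLen (v z)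
    refine ⟨⟨v z + 1, by omega⟩, rfl, ⟨_, hl⟩, rfl, ⟨v i * blockLen (v z), by omega⟩, rfl,
      ⟨blockStart (v z + 1) (v p), by omega⟩, rfl, hs, hc.symm⟩
  · rintro ⟨y, hy, l, hl, t, ht, s, hs, hs', hc⟩
    refine ⟨hl ▸ l.2, ?_, ?_⟩
    · rw [hy, hs, hl, ht, hc]
    · rw [hy, hs, hs']

theorem eq_top (z : ι) : Definable fun n v => top n = v z := by
  refine ((blockLen_lt z).not.and (all (R := fun n v y => (y : ℕ) < v z → blockLen y < n)
    ((lt _ _).imp (blockLen_lt _)))).congr fun n v => ?_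
  simp only [blockLen_lt_iff]
  constructor
  · intro h
    exact ⟨by omega, fun y hy => by omega⟩
  · rintro ⟨h₁, h₂⟩
    have := (v z).2
    by_contra h
    have := h₂ ⟨top n, by omega⟩ (by simp only; omega)
    exact lt_irrefl _ this

theorem last (z : ι) : Definable fun n v => (v z : ℕ) + 1 = n := by
  refine (all (R := fun n v y => (y : ℕ) ≤ v z) (le _ _)).congr fun n v => ?_
  have := (v z).2
  constructor
  · intro h y
    omega
  · intro h
    have := h ⟨n - 1, by omega⟩
    simp only at this
    omega

end Definable

/-- The levels `0, …, top n`, which are logarithmically many in `n`. -/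
def levels : FOBound where
  toFun := top
  definable := by
    have : Definable (ι := Fin 1) fun n v => ∀ y : Fin n, (y : ℕ) < v 0 → blockLen y < n :=
      .all (R := fun n v y => (y : ℕ) < v 0 → blockLen y < n)
        ((Definable.lt _ _).imp (Definable.blockLen_lt _))
    obtain ⟨φ, hφ⟩ := this
    refine ⟨φ, fun n z => (hφ n _).trans ?_⟩
    simp only [blockLen_lt_iff]
    constructor
    · intro h
      by_contra h'
      exact lt_irrefl _ (h ⟨top n, by omega⟩ (not_le.1 h'))
    · intro h y hy
      omega

/-- If top n = z + 1, the length of level z is still below n, so both factors in 2^(z+1) ≤ (z+2) ·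
lcm(1, …, z+1) are at most n. -/
theorem two_pow_top_le {n : ℕ} (hn : 2 ≤ n) : 2 ^ top n ≤ 2 * n ^ 2 := by
  rcases Nat.eq_zero_or_pos (top n) with h | h
  · rw [h]
    nlinarith
  · obtain ⟨z, hz⟩ : ∃ z, top n = z + 1 := ⟨top n - 1, by omega⟩
    have h₁ : blockLen z < n := blockLen_lt_iff.2 (by omega)
    have h₂ := lt_blockLen z
    have h₃ : 2 ^ (z + 1) ≤ (z + 1 + 1) * blockLen z := Chebyshev.two_pow_le_mul_lcmUpto (z + 1)
    rw [hz]
    nlinarith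

theorem top_isBigO_log :
    (fun n : ℕ => (top n : ℝ) + 1) =O[Filter.atTop] fun n : ℕ => Real.log (n : ℝ) := by
  -- Logarithms of 2^(top n) ≤ 2n² give (top n + 1) log 2 ≤ 2 log 2 + 2 log n ≤ 4 log n.
  refine Asymptotics.IsBigO.of_bound (4 / Real.log 2) ?_
  filter_upwards [Filter.eventually_ge_atTop 2] with n hn
  have hn' : (2 : ℝ) ≤ n := by exact_mod_cast hn
  have h2 : 0 < Real.log 2 := Real.log_pos (by norm_num)
  have hlog : Real.log 2 ≤ Real.log n := Real.log_le_log (by norm_num) hn'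
  have h : ((2 : ℝ)) ^ top n ≤ 2 * (n : ℝ) ^ 2 := by exact_mod_cast two_pow_top_le hn
  have h' := Real.log_le_log (by positivity) h
  rw [Real.log_pow, Real.log_mul (by norm_num) (by positivity), Real.log_pow] at h'
  push_cast at h'
  rw [Real.norm_of_nonneg (by positivity), Real.norm_of_nonneg (by linarith),
    div_mul_eq_mul_div, le_div_iff₀ h2]
  linarith

/-! ### Blocks -/

theorem blockStart_le (z p : ℕ) : blockStart z p ≤ p := Nat.div_mul_le_self _ _

theorem lt_blockStart_add (z p : ℕ) : p < blockStart z p + blockLen z := by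
  have := Nat.div_add_mod' p (blockLen z)
  have := Nat.mod_lt p (blockLen_pos z)
  unfold blockStart
  omega

@[simp] theorem blockStart_blockStart (z p : ℕ) :
    blockStart z (blockStart z p) = blockStart z p := by
  rw [blockStart, blockStart, Nat.mul_div_cancel _ (blockLen_pos z)]

theorem blockStart_mono (z : ℕ) : Monotone (blockStart z) := fun _ _ h =>
  Nat.mul_le_mul_right _ (Nat.div_le_div_right h)

@[simp] theorem blockStart_zero (p : ℕ) : blockStart 0 p = p := by simp [blockStart]

theorem blockStart_top {n p : ℕ} (hp : p < n) : blockStart (top n) p = 0 := by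
  rw [blockStart, Nat.div_eq_of_lt (hp.trans_le (le_blockLen_top n)), zero_mul]

theorem blockStart_eq_iff {z p q : ℕ} :
    blockStart z p = blockStart z q ↔ p / blockLen z = q / blockLen z :=
  Nat.mul_left_inj (blockLen_pos z).ne'

/-- The blocks are nested: dividing by the longer length is dividing by the shorter one and then by
the quotient k. -/
theorem blockStart_succ_congr {z p q : ℕ} (h : blockStart z p = blockStart z q) :
    blockStart (z + 1) p = blockStart (z + 1) q := by
  obtain ⟨k, hk⟩ := blockLen_dvd_succ z
  rw [blockStart_eq_iff] at h ⊢
  rw [hk, ← Nat.div_div_eq_div_mul, ← Nat.div_div_eq_div_mul, h]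

theorem blockStart_congr {x z p q : ℕ} (hxz : x ≤ z) (h : blockStart x p = blockStart x q) :
    blockStart z p = blockStart z q := by
  induction z, hxz using Nat.le_induction with
  | base => exact h
  | succ z _ ih => exact blockStart_succ_congr ih

/-- A start of level z is a multiple of `blockLen z` away from the start of the surrounding block,
and an index i ≥ z + 2 would leave that block by `blockLen_succ_le`. -/
theorem exists_isChild_iff {z p c : ℕ} : (∃ i ≤ z + 1, IsChild z p i c) ↔
    blockStart z c = c ∧ blockStart (z + 1) c = blockStart (z + 1) p := by
  obtain ⟨k, hk⟩ := blockLen_dvd_succ z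
  have hpos := blockLen_pos z
  have hst : ∀ q, blockStart (z + 1) q = q / blockLen (z + 1) * k * blockLen z := fun q => by
    rw [blockStart, hk]; ring
  constructor
  · rintro ⟨i, -, hc, hs⟩
    refine ⟨?_, hs⟩
    rw [hst, ← add_mul] at hc
    rw [hc, blockStart, Nat.mul_div_cancel _ hpos]
  · rintro ⟨hc, hs⟩
    have hle := blockStart_le (z + 1) c
    have hlt := lt_blockStart_add (z + 1) c
    have hlen := blockLen_succ_le z
    obtain ⟨i, hi⟩ : blockLen z ∣ c - blockStart (z + 1) c := by
      refine Nat.dvd_sub ?_ ?_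
      · rw [← hc]
        exact dvd_mul_left _ _
      · rw [hst]
        exact dvd_mul_left _ _
    refine ⟨i, ?_, ?_, hs⟩
    · by_contra h
      have : (z + 2) * blockLen z ≤ blockLen z * i := by
        rw [mul_comm]
        exact Nat.mul_le_mul_left _ (by omega)
      omega
    · rw [← hs, mul_comm, ← hi]
      omega

/-! ### Minima over blocks -/

/-- The minimum of `h` over the part inside `{0, …, n-1}` of the block of level `z` containing
`p`. -/
noncomputable def blockMin (h : ℕ → ℤ) (n z p : ℕ) : ℤ :=
  sInf (h '' {q | q < n ∧ blockStart z q = blockStart z p})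

section BlockMin

variable {h h' : ℕ → ℤ} {n z p q : ℕ}

theorem blockMin_congr (hpq : blockStart z p = blockStart z q) :
    blockMin h n z p = blockMin h n z q := by
  rw [blockMin, blockMin, hpq]

theorem finite_block (h : ℕ → ℤ) (n z p : ℕ) :
    (h '' {q | q < n ∧ blockStart z q = blockStart z p}).Finite :=
  ((Set.finite_lt_nat n).subset fun _ hq => hq.1).image h

theorem blockMin_le (hq : q < n) (hqp : blockStart z q = blockStart z p) :
    blockMin h n z p ≤ h q :=
  csInf_le (finite_block h n z p).bddBelow ⟨q, ⟨hq, hqp⟩, rfl⟩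

theorem exists_eq_blockMin (h : ℕ → ℤ) (z : ℕ) (hp : p < n) :
    ∃ q < n, blockStart z q = blockStart z p ∧ h q = blockMin h n z p := by
  obtain ⟨q, ⟨hq, hqp⟩, he⟩ := Int.csInf_mem (s := h '' {q | q < n ∧ blockStart z q = blockStart z p})
    ⟨h p, p, ⟨hp, rfl⟩, rfl⟩ (finite_block h n z p).bddBelow
  exact ⟨q, hq, hqp, he⟩

theorem blockMin_eq (hq : q < n) (hqp : blockStart z q = blockStart z p)
    (hmin : ∀ r < n, blockStart z r = blockStart z p → h q ≤ h r) : blockMin h n z p = h q := by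
  refine IsLeast.csInf_eq ⟨⟨q, ⟨hq, hqp⟩, rfl⟩, ?_⟩
  rintro _ ⟨r, ⟨hr, hrp⟩, rfl⟩
  exact hmin r hr hrp

@[simp] theorem blockMin_zero (h : ℕ → ℤ) (hp : p < n) : blockMin h n 0 p = h p :=
  blockMin_eq hp rfl fun r _ hr => by simp at hr; rw [hr]

theorem blockMin_succ_le (hp : p < n) : blockMin h n (z + 1) p ≤ blockMin h n z p := by
  obtain ⟨q, hq, hqp, he⟩ := exists_eq_blockMin h z hp
  exact he ▸ blockMin_le hq (blockStart_succ_congr hqp)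

theorem blockMin_le_of_le {x : ℕ} (hp : p < n) (hxz : x ≤ z) :
    blockMin h n z p ≤ blockMin h n x p := by
  induction z, hxz using Nat.le_induction with
  | base => exact le_rfl
  | succ z _ ih => exact (blockMin_succ_le hp).trans ih

/-- Minima can only decrease along the growing blocks around p, so they agree at both ends iff they
agree at every step. -/
theorem eq_blockMin_iff (hp : p < n) :
    h p = blockMin h n z p ↔ ∀ x < z, blockMin h n x p = blockMin h n (x + 1) p := by
  constructor
  · intro he x hx
    refine le_antisymm ?_ (blockMin_succ_le hp)
    calc blockMin h n x p ≤ blockMin h n 0 p := blockMin_le_of_le hp (Nat.zero_le _)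
      _ = blockMin h n z p := by rw [blockMin_zero h hp, he]
      _ ≤ blockMin h n (x + 1) p := blockMin_le_of_le hp hx
  · induction z with
    | zero => exact fun _ => (blockMin_zero h hp).symm
    | succ z ih =>
      intro hx
      rw [ih fun x hx' => hx x (by omega), hx z (by omega)]

/-- Whether a minimum of the block of `p` is attained in a set `T` of positions can be read off from
the subblocks branching off the path to `p`, provided that every such subblock that meets `T` is
contained in `T`, which is tested by `t` at its first position. -/
theorem exists_mem_eq_blockMin_iff {T : ℕ → Prop} {t : ℕ → ℕ → Prop} (hp : p < n) (hz : 0 < z)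
    (hsound : ∀ y c r, t y c → blockStart y r = c → T r)
    (hcomplete : ∀ y q, T q → blockStart y q ≠ blockStart y p → t y (blockStart y q))
    (hbase : ∀ q, T q → t 0 q) :
    (∃ q < n, T q ∧ blockStart z q = blockStart z p ∧ h q = blockMin h n z p) ↔
      ∃ y < z, ∃ c < n, (blockStart y c = c ∧ blockStart (y + 1) c = blockStart (y + 1) p) ∧
        t y c ∧ blockMin h n y c = blockMin h n (y + 1) c ∧
        ∀ x < z, y < x → blockMin h n x p = blockMin h n (x + 1) p := by
  constructor
  · obtain ⟨z, rfl⟩ : ∃ k, z = k + 1 := ⟨z - 1, by omega⟩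
    clear hz
    rintro ⟨q, hq, hT, hqp, he⟩
    have hstart : ∀ y, blockStart y q < n := fun y => (blockStart_le y q).trans_lt hq
    induction z with
    | zero =>
      refine ⟨0, by omega, q, hq, ⟨by simp, hqp⟩, hbase q hT, ?_, fun x _ _ => by omega⟩
      rw [blockMin_zero h hq, he, blockMin_congr hqp]
    | succ z ih =>
      -- Either q shares the next smaller block with p and the induction hypothesis applies, or the
      -- subblock of q branches off the path at this level.
      by_cases hs : blockStart (z + 1) q = blockStart (z + 1) p
      · have hpath : blockMin h n (z + 1) p = blockMin h n (z + 1 + 1) p :=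
          le_antisymm ((blockMin_le hq hs).trans he.le) (blockMin_succ_le hp)
        obtain ⟨y, hy, c, hc, hcs, ht, hD, hx⟩ := ih hs (he.trans hpath.symm)
        refine ⟨y, by omega, c, hc, hcs, ht, hD, fun x hxz hyx => ?_⟩
        rcases Nat.lt_or_ge x (z + 1) with h' | h'
        · exact hx x h' hyx
        · obtain rfl : x = z + 1 := by omega
          exact hpath
      · have hsucc := blockStart_succ_congr (blockStart_blockStart (z + 1) q)
        refine ⟨z + 1, by omega, blockStart (z + 1) q, hstart _, ⟨by simp, hsucc.trans hqp⟩,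
          hcomplete _ _ hT hs, ?_, fun x _ _ => by omega⟩
        refine le_antisymm ?_ (blockMin_succ_le (hstart _))
        rw [blockMin_congr (hsucc.trans hqp), ← he]
        exact blockMin_le hq (by simp)
  · rintro ⟨y, hy, c, hc, ⟨hcy, hcp⟩, ht, hD, hx⟩
    -- A lowest position of the block at c is in T by `hsound`; the equalities along the path carry
    -- its minimality up to level z.
    obtain ⟨q, hq, hqc, he⟩ := exists_eq_blockMin h y hc
    refine ⟨q, hq, hsound y c q ht (by rw [hqc, hcy]),
      blockStart_congr hy ((blockStart_succ_congr hqc).trans hcp), ?_⟩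
    rw [he, hD, blockMin_congr hcp]
    clear hz
    induction z, hy using Nat.le_induction with
    | base => rfl
    | succ z hz ih => rw [ih fun x hxz => hx x (by omega), hx z (by omega) (by omega)]

theorem exists_lt_eq_blockMin_iff (hp : p < n) (hz : 0 < z) :
    (∃ q < n, q < p ∧ blockStart z q = blockStart z p ∧ h q = blockMin h n z p) ↔
      ∃ y < z, ∃ c < n, (blockStart y c = c ∧ blockStart (y + 1) c = blockStart (y + 1) p) ∧
        c < blockStart y p ∧ blockMin h n y c = blockMin h n (y + 1) c ∧
        ∀ x < z, y < x → blockMin h n x p = blockMin h n (x + 1) p := by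
  refine exists_mem_eq_blockMin_iff (T := (· < p)) (t := fun y c => c < blockStart y p) hp hz
    ?_ ?_ ?_
  · rintro y c r ht rfl
    by_contra hpr
    exact absurd (blockStart_mono y (not_lt.1 hpr)) (not_le.2 ht)
  · exact fun y q hT hne => lt_of_le_of_ne (blockStart_mono y hT.le) hne
  · exact fun q hT => by simpa using hT

/-- The test `p ≤ c` also admits the block of p itself when it starts at p; all of it then lies on
the required side. -/
theorem exists_ge_eq_blockMin_iff (hp : p < n) (hz : 0 < z) :
    (∃ q < n, p ≤ q ∧ blockStart z q = blockStart z p ∧ h q = blockMin h n z p) ↔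
      ∃ y < z, ∃ c < n, (blockStart y c = c ∧ blockStart (y + 1) c = blockStart (y + 1) p) ∧
        p ≤ c ∧ blockMin h n y c = blockMin h n (y + 1) c ∧
        ∀ x < z, y < x → blockMin h n x p = blockMin h n (x + 1) p := by
  refine exists_mem_eq_blockMin_iff (T := (p ≤ ·)) (t := fun _ c => p ≤ c) hp hz ?_ ?_ ?_
  · rintro y c r ht rfl
    exact ht.trans (blockStart_le y r)
  · intro y q hT hne
    by_contra hlt
    refine hne (le_antisymm ?_ (blockStart_mono y hT))
    have := blockStart_mono y (not_le.1 hlt).le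
    rwa [blockStart_blockStart] at this
  · exact fun q hT => hT

/-- The depth of the block of level `z` starting at `a`: the height of its first position above its
lowest one. -/
noncomputable def depth (h : ℕ → ℤ) (n z a : ℕ) : ℕ := (h a - blockMin h n z a).toNat

theorem coe_depth {a : ℕ} (ha : a < n) : (depth h n z a : ℤ) = h a - blockMin h n z a :=
  Int.toNat_of_nonneg (sub_nonneg.2 (blockMin_le ha rfl))

-- Effect of a change on the depth of a block

variable {δ : ℤ} {a : ℕ}

/-- The positions of the block lie either all before p or all from p on, so their heights shift by a
common constant, which cancels in the depth. -/
theorem depth_eq_of_ne (hh : ∀ q, h' q = h q + if p ≤ q then δ else 0) (ha : a < n)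
    (hs : blockStart z a = a) (hne : blockStart z p ≠ a ∨ p = a) :
    depth h' n z a = depth h n z a := by
  have hconst : ∀ q, blockStart z q = a → (p ≤ q ↔ p ≤ a) := by
    intro q hq
    constructor
    · intro hpq
      rcases hne with hne | rfl
      · have h₁ := blockStart_mono z hpq
        rw [hq] at h₁
        have h₂ := lt_blockStart_add z q
        by_contra hlt
        have h₃ := blockStart_mono z (not_le.1 hlt).le
        rw [hs] at h₃
        omega
      · exact le_rfl
    · intro hpa
      exact hpa.trans (hq ▸ blockStart_le z q)
  obtain ⟨q, hq, hqa, he⟩ := exists_eq_blockMin h z ha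
  have hmin : blockMin h' n z a = h' q := by
    refine blockMin_eq hq hqa fun r hr hra => ?_
    have hle := blockMin_le (h := h) hr hra
    rw [hh, hh, if_congr (hconst q (hqa.trans hs)) rfl rfl,
      if_congr (hconst r (hra.trans hs)) rfl rfl]
    omega
  rw [depth, depth, hmin, hh, hh, if_congr (hconst q (hqa.trans hs)) rfl rfl, ← he]
  congr 1
  ring

/-- No height drops, and both the start of the block and the minimal position before p keep theirs.
-/
theorem depth_eq_of_exists_lt (hh : ∀ q, h' q = h q + if p ≤ q then 1 else 0)
    (hne : blockStart z p ≠ p)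
    (hex : ∃ q < n, q < p ∧ blockStart z q = blockStart z p ∧ h q = blockMin h n z p) :
    depth h' n z (blockStart z p) = depth h n z (blockStart z p) := by
  have hlt : blockStart z p < p := lt_of_le_of_ne (blockStart_le z p) hne
  obtain ⟨q, hq, hqp, hs, he⟩ := hex
  have hmin : blockMin h' n z p = h' q := by
    refine blockMin_eq hq hs fun r hr hrp => ?_
    have hle := blockMin_le (h := h) hr hrp
    rw [hh, hh, if_neg (by omega)]
    split <;> omega
  have hc : ∀ h, blockMin h n z (blockStart z p) = blockMin h n z p := fun h =>
    blockMin_congr (by simp)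
  rw [depth, depth, hc, hc, hmin, hh, hh, if_neg (by omega), if_neg (by omega), he]
  simp

/-- Heights before p exceed the minimum by at least one, while those from p on rise by exactly one.
So the minimum rises by one, and the start, being before p, keeps its height. -/
theorem depth_add_one_of_not_exists_lt (hh : ∀ q, h' q = h q + if p ≤ q then 1 else 0) (hp : p < n)
    (hne : blockStart z p ≠ p)
    (hex : ¬ ∃ q < n, q < p ∧ blockStart z q = blockStart z p ∧ h q = blockMin h n z p) :
    depth h' n z (blockStart z p) + 1 = depth h n z (blockStart z p) := by
  have hlt : blockStart z p < p := lt_of_le_of_ne (blockStart_le z p) hne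
  obtain ⟨q, hq, hs, he⟩ := exists_eq_blockMin h z hp
  have hstrict : ∀ r < n, r < p → blockStart z r = blockStart z p → h q < h r := fun r hr hrp hrs => by
    rw [he]
    exact lt_of_le_of_ne (blockMin_le hr hrs) fun he' => hex ⟨r, hr, hrp, hrs, he'.symm⟩
  have hpq : p ≤ q := by
    by_contra hqp
    exact hex ⟨q, hq, not_le.1 hqp, hs, he⟩
  have hmin : blockMin h' n z p = h' q := by
    refine blockMin_eq hq hs fun r hr hrp => ?_
    have hle := blockMin_le (h := h) hr hrp
    rw [hh, hh, if_pos hpq]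
    split
    · omega
    · have := hstrict r hr (by omega) hrp
      omega
  have hc : ∀ h, blockMin h n z (blockStart z p) = blockMin h n z p := fun h =>
    blockMin_congr (by simp)
  have hst := hstrict (blockStart z p) (by omega) hlt (by simp)
  rw [depth, depth, hc, hc, hmin, hh, hh, if_pos hpq, if_neg (by omega), ← he]
  omega

/-- A minimal position from p on drops by one, and no height drops by more. -/
theorem depth_eq_add_one_of_exists_ge (hh : ∀ q, h' q = h q + if p ≤ q then -1 else 0) (hp : p < n)
    (hne : blockStart z p ≠ p)
    (hex : ∃ q < n, p ≤ q ∧ blockStart z q = blockStart z p ∧ h q = blockMin h n z p) :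
    depth h' n z (blockStart z p) = depth h n z (blockStart z p) + 1 := by
  have hlt : blockStart z p < p := lt_of_le_of_ne (blockStart_le z p) hne
  obtain ⟨q, hq, hqp, hs, he⟩ := hex
  have hmin : blockMin h' n z p = h' q := by
    refine blockMin_eq hq hs fun r hr hrp => ?_
    have hle := blockMin_le (h := h) hr hrp
    rw [hh, hh, if_pos hqp]
    split <;> omega
  have hc : ∀ h, blockMin h n z (blockStart z p) = blockMin h n z p := fun h =>
    blockMin_congr (by simp)
  have hle := blockMin_le (h := h) (z := z) (p := p) (q := blockStart z p) (n := n) (by omega)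
    (by simp)
  rw [depth, depth, hc, hc, hmin, hh, hh, if_pos hqp, if_neg (by omega), ← he]
  omega

/-- Heights from p on exceed the minimum by at least one, so after the drop they are still not below
it, and it remains attained before p. -/
theorem depth_eq_of_not_exists_ge (hh : ∀ q, h' q = h q + if p ≤ q then -1 else 0) (hp : p < n)
    (hne : blockStart z p ≠ p)
    (hex : ¬ ∃ q < n, p ≤ q ∧ blockStart z q = blockStart z p ∧ h q = blockMin h n z p) :
    depth h' n z (blockStart z p) = depth h n z (blockStart z p) := by
  have hlt : blockStart z p < p := lt_of_le_of_ne (blockStart_le z p) hne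
  obtain ⟨q, hq, hs, he⟩ := exists_eq_blockMin h z hp
  have hqp : q < p := by
    by_contra hqp
    exact hex ⟨q, hq, not_lt.1 hqp, hs, he⟩
  have hmin : blockMin h' n z p = h' q := by
    refine blockMin_eq hq hs fun r hr hrp => ?_
    have hle := blockMin_le (h := h) hr hrp
    rw [hh, hh, if_neg (by omega)]
    split
    · rename_i hpr
      have : blockMin h n z p ≠ h r := fun he' => hex ⟨r, hr, hpr, hrp, he'.symm⟩
      omega
    · omega
  have hc : ∀ h, blockMin h n z (blockStart z p) = blockMin h n z p := fun h =>
    blockMin_congr (by simp)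
  rw [depth, depth, hc, hc, hmin, hh, hh, if_neg (by omega), if_neg (by omega), ← he]
  simp

end BlockMin

/-! ### Counting letters -/

section Words

variable {n : ℕ}

/-- The letter at position `q`, where no letter is found outside the word. -/
def letter (w : Fin n → Option DyckStep) (q : ℕ) : Option DyckStep :=
  if h : q < n then w ⟨q, h⟩ else none

/-- The number of letters `σ` at the positions `0, …, q`. -/
def count (w : Fin n → Option DyckStep) (σ : DyckStep) (q : ℕ) : ℕ :=
  Nat.count (fun r => letter w r = some σ) (q + 1)

/-- The number of opening minus the number of closing parentheses at the positions `0, …, q`. -/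
def height (w : Fin n → Option DyckStep) (q : ℕ) : ℤ := count w .U q - count w .D q

variable (w : Fin n → Option DyckStep)

@[simp] theorem letter_coe (i : Fin n) : letter w i = w i := by simp [letter]

theorem letter_update (p : Fin n) (l : Option DyckStep) (q : ℕ) :
    letter (Function.update w p l) q = if q = p then l else letter w q := by
  by_cases hq : q < n
  · simp [letter, hq, Function.update_apply, Fin.ext_iff]
  · simp only [letter, hq, dite_false]
    rw [if_neg]
    omega

theorem count_update (p : Fin n) (l : Option DyckStep) (σ : DyckStep) (q : ℕ) :
    (count (Function.update w p l) σ q : ℤ) = count w σ q + if (p : ℕ) ≤ q then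
      (if l = some σ then 1 else 0) - (if w p = some σ then 1 else 0) else 0 := by
  have : ∀ k, ((Nat.count (fun r => letter (Function.update w p l) r = some σ) k : ℕ) : ℤ) =
      Nat.count (fun r => letter w r = some σ) k + if (p : ℕ) < k then
        (if l = some σ then 1 else 0) - (if w p = some σ then 1 else 0) else 0 := by
    intro k
    induction k with
    | zero => simp
    | succ k ih =>
      rw [Nat.count_succ, Nat.count_succ]
      push_cast
      rw [ih, letter_update]
      rcases lt_trichotomy (p : ℕ) k with h | h | h
      · simp only [if_pos h, if_pos (h.trans k.lt_succ_self), if_neg h.ne']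
        ring
      · subst h
        simp only [if_neg (lt_irrefl _), if_pos (Nat.lt_succ_self _), if_true, letter_coe]
        ring
      · simp only [if_neg h.not_gt, if_neg (not_lt.2 (Nat.succ_le_of_lt h)), if_neg h.ne]
        ring
  rw [count, count, this]
  simp only [Nat.lt_succ_iff]

theorem count_mono (σ : DyckStep) : Monotone (count w σ) := fun _ _ h =>
  Nat.count_monotone _ (Nat.succ_le_succ h)

/-- Each position carries at most one letter, so there are at most b - a letters in (a, b]. -/
theorem count_add_count_le {a b : ℕ} (hab : a ≤ b) :
    count w .U b + count w .D b + a ≤ count w .U a + count w .D a + b := by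
  induction b, hab using Nat.le_induction with
  | base => exact le_rfl
  | succ b _ ih =>
    have hU : count w .U (b + 1) = count w .U b + if letter w (b + 1) = some .U then 1 else 0 :=
      Nat.count_succ _ _
    have hD : count w .D (b + 1) = count w .D b + if letter w (b + 1) = some .D then 1 else 0 :=
      Nat.count_succ _ _
    rw [hU, hD]
    by_cases h : letter w (b + 1) = some .U
    · rw [if_pos h, if_neg (by rw [h]; simp)]
      omega
    · rw [if_neg h]
      split <;> omega

theorem count_take_ofFn (σ : DyckStep) (k : ℕ) :
    ((List.ofFn w).take k).count (some σ) = Nat.count (fun r => letter w r = some σ) k := by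
  induction k with
  | zero => simp
  | succ k ih =>
    rw [List.take_add_one, List.count_append, ih, Nat.count_succ, List.getElem?_ofFn]
    congr 1
    by_cases hk : k < n
    · simp [hk, letter, List.count_singleton]
    · simp [hk, letter]

theorem count_reduceOption (l : List (Option DyckStep)) (σ : DyckStep) :
    l.reduceOption.count σ = l.count (some σ) := by
  induction l with
  | nil => rfl
  | cons x l ih =>
    cases x with
    | none => rw [List.reduceOption_cons_of_none, ih, List.count_cons_of_ne (by simp)]
    | some x => rw [List.reduceOption_cons_of_some, List.count_cons, List.count_cons, ih]; simp

theorem mem_dyckLanguage_iff (l : List DyckStep) : l ∈ dyckLanguage ↔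
    l.count .U = l.count .D ∧ ∀ i, (l.take i).count .D ≤ (l.take i).count .U :=
  ⟨fun ⟨d, hd⟩ => hd ▸ ⟨d.count_U_eq_count_D, d.count_D_le_count_U⟩,
    fun ⟨h₁, h₂⟩ => ⟨⟨l, h₁, h₂⟩, rfl⟩⟩

/-- Every prefix of the reduced word is the reduction of a prefix of the original one, and
conversely, so empty positions need not be removed before counting. -/
theorem reduceOption_mem_dyckLanguage_iff (l : List (Option DyckStep)) :
    l.reduceOption ∈ dyckLanguage ↔ l.count (some .U) = l.count (some .D) ∧
      ∀ i, (l.take i).count (some .D) ≤ (l.take i).count (some .U) := by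
  simp only [mem_dyckLanguage_iff, ← count_reduceOption]
  refine and_congr_right fun _ => ⟨fun h i => ?_, fun h i => ?_⟩
  · have := (List.take_prefix i l).filterMap id
    rw [List.prefix_iff_eq_take] at this
    rw [List.reduceOption, this]
    exact h _
  · obtain ⟨m, hm, he⟩ := List.prefix_filterMap_iff.1 (List.take_prefix i l.reduceOption)
    rw [List.prefix_iff_eq_take] at hm
    rw [he, hm]
    exact h _

theorem word_mem_dyckLanguage_iff (hn : 0 < n) :
    (List.ofFn w).reduceOption ∈ dyckLanguage ↔
      height w (n - 1) = 0 ∧ ∀ q < n, 0 ≤ height w q := by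
  have hlen : (List.ofFn w).length = n := List.length_ofFn
  have hfull : ∀ k, n ≤ k → (List.ofFn w).take k = (List.ofFn w).take n := fun k hk => by
    rw [List.take_of_length_le (hlen.trans_le hk), List.take_of_length_le hlen.le]
  have htake : ∀ σ k, 0 < k → ((List.ofFn w).take k).count (some σ) = count w σ (k - 1) := by
    intro σ k hk
    rw [count_take_ofFn, count, Nat.sub_add_cancel hk]
  have hU := htake .U n hn
  have hD := htake .D n hn
  rw [List.take_of_length_le hlen.le] at hU hD
  rw [reduceOption_mem_dyckLanguage_iff, hU, hD]
  simp only [height, sub_eq_zero, Nat.cast_inj, sub_nonneg, Nat.cast_le]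
  refine and_congr_right fun _ => ⟨fun h q hq => ?_, fun h i => ?_⟩
  · have := h (q + 1)
    rwa [htake _ _ (by omega), htake _ _ (by omega), Nat.add_sub_cancel] at this
  · rcases Nat.eq_zero_or_pos i with rfl | hi
    · simp
    · rcases Nat.lt_or_ge i n with hin | hin
      · rw [htake _ _ hi, htake _ _ hi]
        exact h _ (by omega)
      · rw [hfull i hin, htake _ _ hn, htake _ _ hn]
        exact h _ (by omega)

/-- The depth is at most the number of closing parentheses in (a, q], where q is a lowest position.
-/
theorem depth_lt {z a : ℕ} (ha : a < n) (hs : blockStart z a = a) : depth (height w) n z a < n := by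
  obtain ⟨q, hq, hqa, he⟩ := exists_eq_blockMin (height w) z ha
  have haq : a ≤ q := by
    rw [← hs, ← hqa]
    exact blockStart_le z q
  have h₁ := count_mono w .U haq
  have h₂ := count_mono w .D haq
  have h₃ := count_add_count_le w haq
  have := coe_depth (h := height w) (z := z) ha
  rw [← he, height, height] at this
  omega

variable {w}

/-- No sum in the comparison of a block with the surrounding one exceeds `n - 1`. -/
theorem count_add_depth_lt {z c : ℕ} (hc : c < n) (hs : blockStart z c = c) :
    count w .U c - count w .U (blockStart (z + 1) c) +
        depth (height w) n (z + 1) (blockStart (z + 1) c) < n ∧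
      count w .D c - count w .D (blockStart (z + 1) c) + depth (height w) n z c < n := by
  set a := blockStart (z + 1) c with ha
  have hac : a ≤ c := blockStart_le _ _
  have hU := count_mono w .U hac
  have hD := count_mono w .D hac
  have hd := coe_depth (h := height w) (z := z + 1) (n := n) (a := a) (by omega)
  have hd' := coe_depth (h := height w) (z := z) hc
  obtain ⟨q, hq, hqa, he⟩ := exists_eq_blockMin (height w) (z + 1) (p := a) (n := n) (by omega)
  obtain ⟨r, hr, hrc, he'⟩ := exists_eq_blockMin (height w) z hc
  have haq : a ≤ q := by
    have := blockStart_le (z + 1) q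
    rwa [hqa, ha, blockStart_blockStart] at this
  have hcr : c ≤ r := by
    have := blockStart_le z r
    rwa [hrc, hs] at this
  rw [← he, height, height] at hd
  rw [← he', height, height] at hd'
  constructor
  -- If c ≤ q, the sum is at most the number of closing parentheses in (a, q]. Otherwise it counts
  -- opening ones in (q, c] and closing ones in (a, q], at most c - a in all.
  · have h₃ := count_add_count_le w haq
    have h₄ := count_add_count_le w hac
    rcases le_total c q with h | h
    · have := count_mono w .U h
      omega
    · have := count_mono w .U h
      have := count_mono w .D h
      have := count_mono w .U haq
      have := count_mono w .D haq
      have := count_add_count_le w h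
      omega
  -- The sum is at most the number of closing parentheses in (a, r].
  · have h₃ := count_add_count_le w (hac.trans hcr)
    have h₄ := count_mono w .U hcr
    have h₅ := count_mono w .D hcr
    omega

/-- Each minimum is height minus depth at the start of its block, and the two heights enter only
through their difference, which the letter counts in (a, c] determine. Terms are moved across so
that only sums occur, as subtraction is not available in terms. -/
theorem blockMin_eq_iff_count {z c : ℕ} (hc : c < n) :
    blockMin (height w) n z c = blockMin (height w) n (z + 1) c ↔
      count w .U c - count w .U (blockStart (z + 1) c) +
          depth (height w) n (z + 1) (blockStart (z + 1) c) =
        count w .D c - count w .D (blockStart (z + 1) c) + depth (height w) n z c := by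
  have hac := blockStart_le (z + 1) c
  have hU := count_mono w .U hac
  have hD := count_mono w .D hac
  have hd := coe_depth (h := height w) (z := z + 1) (n := n) (a := blockStart (z + 1) c) (by omega)
  have hd' := coe_depth (h := height w) (z := z) hc
  rw [blockMin_congr (blockStart_blockStart (z + 1) c), height] at hd
  rw [height] at hd'
  omega

end Words

/-! ### The auxiliary schema -/

instance : Fintype DyckStep := ⟨{.U, .D}, by rintro (_ | _) <;> simp⟩

/-- The auxiliary functions. `count σ` and `depth` depend on the word, the others are arithmetic. -/
inductive DyckFunc
  | count (σ : DyckStep)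
  | depth
  | start
  | child
  | succ
  | pred
  | last
  | top
  deriving Fintype

/-- The auxiliary schema: a unary relation for every letter, and the functions `DyckFunc`. -/
abbrev dyckSchema : Schema where
  Rel := DyckStep
  Func := DyckFunc
  relFintype := inferInstance
  funcFintype := inferInstance
  relArity _ := 1
  funcArity
    | .count _ => 2
    | .depth => 2
    | .start => 2
    | .child => 3
    | .succ => 1
    | .pred => 1
    | .last => 0
    | .top => 0

/-- The graphs of the arithmetic functions and of the initial values of the other ones. -/
def initGraph (n : ℕ) : (f : DyckFunc) → (Fin (dyckSchema.funcArity f) ⊕ Unit → Fin n) → Prop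
  | .count _, v => (v (.inr ()) : ℕ) = 0
  | .depth, v => (v (.inr ()) : ℕ) = 0
  | .start, v => blockStart (v (.inl (0 : Fin 2))) (v (.inl (1 : Fin 2))) = v (.inr ())
  | .child, v => blockLen (v (.inl (0 : Fin 3))) < n ∧
      IsChild (v (.inl (0 : Fin 3))) (v (.inl (1 : Fin 3))) (v (.inl (2 : Fin 3))) (v (.inr ()))
  | .succ, v => (v (.inl (0 : Fin 1)) : ℕ) + 1 = v (.inr ())
  | .pred, v => (v (.inr ()) : ℕ) + 1 = v (.inl (0 : Fin 1))
  | .last, v => (v (.inr ()) : ℕ) + 1 = n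
  | .top, v => top n = v (.inr ())

theorem definable_initGraph (f : DyckFunc) : Definable fun n => initGraph n f := by
  cases f
  · exact .zero _
  · exact .zero _
  · exact .blockStart_eq _ _ _
  · exact .isChild _ _ _ _
  · exact .succ _ _
  · exact .succ _ _
  · exact .last _
  · exact .eq_top _

theorem initGraph_unique {n : ℕ} {f : DyckFunc} {v : Fin (dyckSchema.funcArity f) → Fin n}
    {a b : Fin n} (ha : initGraph n f (Sum.elim v fun _ => a))
    (hb : initGraph n f (Sum.elim v fun _ => b)) : a = b := by
  ext
  cases f <;> simp only [initGraph, IsChild, Sum.elim_inl, Sum.elim_inr] at ha hb <;> omega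

theorem the?_eq_some_iff {α : Type} {p : α → Prop} (hp : ∀ a b, p a → p b → a = b) {b : α} :
    the? p = some b ↔ p b := by
  unfold the?
  split
  · rename_i h
    rw [Option.some_inj]
    exact ⟨fun he => he ▸ h.choose_spec.1, fun hb => hp _ _ h.choose_spec.1 hb⟩
  · rename_i h
    simp only [reduceCtorEq, false_iff]
    exact fun hb => h ⟨b, hb, fun a ha => hp _ _ ha hb⟩

theorem tuple?_eq_some_iff {ι α : Type} {v : ι → Option α} {a : ι → α} :
    tuple? v = some a ↔ ∀ i, v i = some (a i) := by
  unfold tuple?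
  split
  · rename_i h
    rw [Option.some_inj]
    refine ⟨fun he => he ▸ h.choose_spec, fun ha => funext fun i => ?_⟩
    exact Option.some_inj.1 ((h.choose_spec i).symm.trans (ha i))
  · rename_i h
    simp only [reduceCtorEq, false_iff]
    exact fun ha => h ⟨a, ha⟩

/-! ### Terms and conditions over the auxiliary schema -/

section Expressions

variable {k : ℕ}

def countT (σ : DyckStep) (z c : Term dyckSchema k) : Term dyckSchema k :=
  .app (.count σ) ![z, c]

def depthT (z c : Term dyckSchema k) : Term dyckSchema k := .app .depth ![z, c]

def startT (z p : Term dyckSchema k) : Term dyckSchema k := .app .start ![z, p]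

def childT (z p i : Term dyckSchema k) : Term dyckSchema k := .app .child ![z, p, i]

def succT (t : Term dyckSchema k) : Term dyckSchema k := .app .succ ![t]

def predT (t : Term dyckSchema k) : Term dyckSchema k := .app .pred ![t]

def lastT : Term dyckSchema k := .app .last ![]

def topT : Term dyckSchema k := .app .top ![]

def letterC (σ : DyckStep) (p : Term dyckSchema k) : Cond dyckSchema k := .rel σ ![p]

def ltC (s t : Term dyckSchema k) : Cond dyckSchema k := .and (.le s t) (.not (.eq s t))

def falseC : Cond dyckSchema k := .not (.eq .undef .undef)

/-- The block of level `z` starting at `c` has the same minimum as the block of level `z + 1`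
containing both `c` and `p`. -/
def lowC (z c p : Term dyckSchema k) : Cond dyckSchema k :=
  .eq (.add (countT .U z c) (depthT (succT z) (startT (succT z) p)))
    (.add (countT .D z c) (depthT z c))

end Expressions

/-- The minimum of the block of level `z` containing `p` is attained in the set of positions
described by the side condition `s(p, z, y, i)` on the `i`-th child of level `y`. -/
def attainC (s : Cond dyckSchema 4) : Cond dyckSchema 2 :=
  .ex levels (.and (ltC (.var 2) (.var 1)) (.and
    (.ex levels (.and s (lowC (.var 2) (childT (.var 2) (.var 0) (.var 3)) (.var 0))))
    (.not (.ex levels (.and (ltC (.var 2) (.var 3)) (.and (ltC (.var 3) (.var 1))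
      (.not (lowC (.var 3) (startT (.var 3) (.var 0)) (.var 0)))))))))

/-- The comparison fails when the child is undefined. This is essential: `lowC` alone would accept
such an index, since both of its sides would be undefined and hence equal. -/
def attainLtC : Cond dyckSchema 2 :=
  attainC (ltC (childT (.var 2) (.var 0) (.var 3)) (startT (.var 2) (.var 0)))

def attainGeC : Cond dyckSchema 2 :=
  attainC (.le (.var 0) (childT (.var 2) (.var 0) (.var 3)))

section Rules

variable {k : ℕ}

/-- The change `δ` writes the letter `σ` at position `p`. -/
def addsC (δ : WordChange DyckStep) (σ : DyckStep) (p : Term dyckSchema k) : Cond dyckSchema k :=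
  match δ with
  | .set τ => if τ = σ then .not (.or (letterC .U p) (letterC .D p)) else falseC
  | .reset => falseC

/-- The change `δ` deletes the letter `σ` at position `p`. -/
def removesC (δ : WordChange DyckStep) (σ : DyckStep) (p : Term dyckSchema k) :
    Cond dyckSchema k :=
  match δ with
  | .set _ => falseC
  | .reset => letterC σ p

/-- The new value of `depth(z, start(z, p))`, with variables `p, z`. -/
def depthBody (δ : WordChange DyckStep) : Term dyckSchema 2 :=
  let d := depthT (.var 1) (startT (.var 1) (.var 0))
  .ite (.eq (startT (.var 1) (.var 0)) (.var 0)) d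
    (.ite (.or (addsC δ .U (.var 0)) (removesC δ .D (.var 0))) (.ite attainLtC d (predT d))
      (.ite (.or (addsC δ .D (.var 0)) (removesC δ .U (.var 0))) (.ite attainGeC (succT d) d) d))

/-- The new value of `count σ (z, child(z, p, i))`, with variables `p, z, i`. -/
def countBody (δ : WordChange DyckStep) (σ : DyckStep) : Term dyckSchema 3 :=
  let c := childT (.var 1) (.var 0) (.var 2)
  let d := countT σ (.var 1) c
  .ite (.and (.le (.var 0) c) (.not (.eq (startT (succT (.var 1)) (.var 0)) (.var 0))))
    (.ite (addsC δ σ (.var 0)) (succT d) (.ite (removesC δ σ (.var 0)) (predT d) d)) d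

def depthRule (δ : WordChange DyckStep) : UpdateRule dyckSchema 1 2 (Term dyckSchema) where
  vars := 1
  bound _ := levels
  target := ![.var 1, startT (.var 1) (.var 0)]
  body := depthBody δ

def countRule (δ : WordChange DyckStep) (σ : DyckStep) :
    UpdateRule dyckSchema 1 2 (Term dyckSchema) where
  vars := 2
  bound _ := levels
  target := ![.var 1, childT (.var 1) (.var 0) (.var 2)]
  body := countBody δ σ

/-- The rule that leaves a function unchanged. -/
def staticRule (f : DyckFunc) :
    UpdateRule dyckSchema 1 (dyckSchema.funcArity f) (Term dyckSchema) where
  vars := 0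
  bound := Fin.elim0
  target _ := .undef
  body := .app f fun _ => .undef

def letterRule (δ : WordChange DyckStep) (σ : DyckStep) :
    UpdateRule dyckSchema 1 1 (Cond dyckSchema) where
  vars := 0
  bound := Fin.elim0
  target _ := .var 0
  body := .or (.and (letterC σ (.var 0)) (.not (removesC δ σ (.var 0)))) (addsC δ σ (.var 0))

/-- The height of the last position is minimal, and the minimal height is zero. -/
def queryC : Cond dyckSchema 0 :=
  let zero := startT topT lastT
  .and
    (.not (.ex levels (.and (ltC (.var 0) topT) (.not (lowC (.var 0) (startT (.var 0) lastT) lastT)))))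
    (.or (.and (letterC .U zero) (.eq (depthT topT zero) (succT zero)))
      (.and (.not (.or (letterC .U zero) (letterC .D zero))) (.eq (depthT topT zero) zero)))

end Rules

/-- The dynamic program for the Dyck language. -/
noncomputable def dyckProgram : DynProgram (memberProblem dyckLanguage) where
  schema := dyckSchema
  initRel _ := ⊥
  initFunc f := (definable_initGraph f).choose
  updateRel δ σ := letterRule δ σ
  updateFunc δ f := match f with
    | .count σ => countRule δ σ
    | .depth => depthRule δ
    | .start => staticRule .start
    | .child => staticRule .child
    | .succ => staticRule .succ
    | .pred => staticRule .pred
    | .last => staticRule .last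
    | .top => staticRule .top
  query _ := queryC

/-! ### Evaluation -/

section Eval

variable {n k : ℕ} {A : Str dyckSchema n} {e : Fin k → Fin n}

/-- The term `t` has the value `x`. -/
def HasVal (A : Str dyckSchema n) (e : Fin k → Fin n) (t : Term dyckSchema k) (x : ℕ) : Prop :=
  ∃ b : Fin n, t.eval A e = some b ∧ (b : ℕ) = x

theorem HasVal.lt {t : Term dyckSchema k} {x : ℕ} (h : HasVal A e t x) : x < n := by
  obtain ⟨b, -, rfl⟩ := h
  exact b.2

theorem HasVal.congr {t : Term dyckSchema k} {x y : ℕ} (h : HasVal A e t x) (hxy : x = y) :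
    HasVal A e t y := hxy ▸ h

theorem hasVal_var (i : Fin k) : HasVal A e (.var i) (e i) := ⟨e i, by simp only [Term.eval], rfl⟩

theorem HasVal.add {s t : Term dyckSchema k} {x y : ℕ} (hs : HasVal A e s x) (ht : HasVal A e t y)
    (h : x + y < n) : HasVal A e (.add s t) (x + y) := by
  obtain ⟨a, ha, rfl⟩ := hs
  obtain ⟨b, hb, rfl⟩ := ht
  exact ⟨⟨_, h⟩, by simp [Term.eval, ha, hb, ofNat?, h], rfl⟩

theorem eval_app {f : DyckFunc} {ts : Fin (dyckSchema.funcArity f) → Term dyckSchema k}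
    {a : Fin (dyckSchema.funcArity f) → Fin n} (h : ∀ i, (ts i).eval A e = some (a i)) :
    (Term.app (τ := dyckSchema) f ts).eval A e = A.func f a := by
  simp only [Term.eval, tuple?_eq_some_iff.2 h, Option.bind_some]

theorem holds_eq_iff {s t : Term dyckSchema k} {x y : ℕ} (hs : HasVal A e s x)
    (ht : HasVal A e t y) : (Cond.eq s t).Holds A e ↔ x = y := by
  obtain ⟨a, ha, rfl⟩ := hs
  obtain ⟨b, hb, rfl⟩ := ht
  simp [Cond.Holds, ha, hb, Fin.ext_iff]

theorem holds_le_iff {s t : Term dyckSchema k} {x y : ℕ} (hs : HasVal A e s x)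
    (ht : HasVal A e t y) : (Cond.le s t).Holds A e ↔ x ≤ y := by
  obtain ⟨a, ha, rfl⟩ := hs
  obtain ⟨b, hb, rfl⟩ := ht
  simp only [Cond.Holds, ha, hb, Option.some_inj]
  exact ⟨fun ⟨_, _, h₁, h₂, h⟩ => h₁ ▸ h₂ ▸ h, fun h => ⟨a, b, rfl, rfl, h⟩⟩

theorem holds_not_iff {c : Cond dyckSchema k} : (Cond.not c).Holds A e ↔ ¬ c.Holds A e := by
  simp only [Cond.Holds]

theorem holds_and_iff {c d : Cond dyckSchema k} :
    (Cond.and c d).Holds A e ↔ c.Holds A e ∧ d.Holds A e := by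
  simp only [Cond.Holds]

theorem holds_or_iff {c d : Cond dyckSchema k} :
    (Cond.or c d).Holds A e ↔ c.Holds A e ∨ d.Holds A e := by
  simp only [Cond.Holds]

theorem holds_ex_iff {c : Cond dyckSchema (k + 1)} : (Cond.ex levels c).Holds A e ↔
    ∃ a : Fin n, (a : ℕ) ≤ top n ∧ c.Holds A (extend e a) := by
  simp only [Cond.Holds]
  exact Iff.rfl

theorem not_holds_falseC : ¬ (falseC : Cond dyckSchema k).Holds A e := by
  simp [falseC, Cond.Holds]

theorem holds_ltC_iff {s t : Term dyckSchema k} {x y : ℕ} (hs : HasVal A e s x)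
    (ht : HasVal A e t y) : (ltC s t).Holds A e ↔ x < y := by
  rw [ltC, holds_and_iff, holds_not_iff, holds_le_iff hs ht, holds_eq_iff hs ht]
  omega

theorem HasVal.ite {c : Cond dyckSchema k} {s t : Term dyckSchema k} {x : ℕ}
    (hs : c.Holds A e → HasVal A e s x) (ht : ¬ c.Holds A e → HasVal A e t x) :
    HasVal A e (.ite c s t) x := by
  by_cases h : c.Holds A e
  · obtain ⟨b, hb, hx⟩ := hs h
    exact ⟨b, by simp only [Term.eval, if_pos h, hb], hx⟩
  · obtain ⟨b, hb, hx⟩ := ht h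
    exact ⟨b, by simp only [Term.eval, if_neg h, hb], hx⟩

/-- The auxiliary structure `A` stores the required information on the word `w`. -/
structure Stores (A : Str dyckSchema n) (w : Fin n → Option DyckStep) : Prop where
  letter_spec : ∀ σ v, A.rel σ v ↔ w (v 0) = some σ
  static_spec : ∀ f v b, f ≠ .depth → (∀ σ, f ≠ .count σ) →
    (A.func f v = some b ↔ initGraph n f (Sum.elim v fun _ => b))
  depth_spec : ∀ v : Fin 2 → Fin n, (v 0 : ℕ) ≤ top n → blockStart (v 0) (v 1) = v 1 →
    ∃ b, A.func .depth v = some b ∧ (b : ℕ) = depth (height w) n (v 0) (v 1)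
  count_spec : ∀ σ, ∀ v : Fin 2 → Fin n, (v 0 : ℕ) < top n → blockStart (v 0) (v 1) = v 1 →
    ∃ b, A.func (.count σ) v = some b ∧
      (b : ℕ) = count w σ (v 1) - count w σ (blockStart (v 0 + 1) (v 1))

namespace Stores

variable {w : Fin n → Option DyckStep} (hA : Stores A w)
include hA

variable {s t u : Term dyckSchema k} {x y i : ℕ}

theorem hasVal_startT (hs : HasVal A e s x) (ht : HasVal A e t y) :
    HasVal A e (startT s t) (blockStart x y) := by
  obtain ⟨a, ha, rfl⟩ := hs
  obtain ⟨b, hb, rfl⟩ := ht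
  refine ⟨⟨blockStart a b, (blockStart_le _ _).trans_lt b.2⟩, ?_, rfl⟩
  rw [startT, eval_app (a := ![a, b]) (Fin.forall_fin_two.2 ⟨ha, hb⟩)]
  exact (hA.static_spec .start _ _ (by simp) (by simp)).2 rfl

theorem hasVal_childT {c : ℕ} (hs : HasVal A e s x) (ht : HasVal A e t y) (hu : HasVal A e u i)
    (hx : x < top n) (hc : c < n) (h : IsChild x y i c) : HasVal A e (childT s t u) c := by
  obtain ⟨a, ha, rfl⟩ := hs
  obtain ⟨b, hb, rfl⟩ := ht
  obtain ⟨j, hj, rfl⟩ := hu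
  refine ⟨⟨c, hc⟩, ?_, rfl⟩
  rw [childT, eval_app (a := ![a, b, j]) (Fin.forall_fin_succ.2 ⟨ha, Fin.forall_fin_two.2 ⟨hb, hj⟩⟩)]
  exact (hA.static_spec .child _ _ (by simp) (by simp)).2 ⟨blockLen_lt_iff.2 hx, h⟩

theorem isChild_of_hasVal {c : ℕ} (hs : HasVal A e s x) (ht : HasVal A e t y)
    (hu : HasVal A e u i) (h : HasVal A e (childT s t u) c) : x < top n ∧ IsChild x y i c := by
  obtain ⟨a, ha, rfl⟩ := hs
  obtain ⟨b, hb, rfl⟩ := ht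
  obtain ⟨j, hj, rfl⟩ := hu
  obtain ⟨c, hc, rfl⟩ := h
  rw [childT, eval_app (a := ![a, b, j])
    (Fin.forall_fin_succ.2 ⟨ha, Fin.forall_fin_two.2 ⟨hb, hj⟩⟩)] at hc
  obtain ⟨h₁, h₂⟩ := (hA.static_spec .child _ _ (by simp) (by simp)).1 hc
  exact ⟨blockLen_lt_iff.1 h₁, h₂⟩

theorem hasVal_succT (hs : HasVal A e s x) (hx : x + 1 < n) : HasVal A e (succT s) (x + 1) := by
  obtain ⟨a, ha, rfl⟩ := hs
  refine ⟨⟨a + 1, hx⟩, ?_, rfl⟩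
  rw [succT, eval_app (a := ![a]) (Fin.forall_fin_one.2 ha)]
  exact (hA.static_spec .succ _ _ (by simp) (by simp)).2 rfl

/-- If y + 1 leaves the domain, the successor is undefined and differs from every defined value, as
it should; the query needs this for n = 1. -/
theorem holds_eq_succT_iff (hs : HasVal A e s x) (ht : HasVal A e t y) :
    (Cond.eq s (succT t)).Holds A e ↔ x = y + 1 := by
  rcases Nat.lt_or_ge (y + 1) n with h | h
  · exact holds_eq_iff hs (hA.hasVal_succT ht h)
  · refine ⟨fun he => ?_, fun he => absurd hs.lt (by omega)⟩
    obtain ⟨a, ha, rfl⟩ := hs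
    obtain ⟨b, hb, rfl⟩ := ht
    simp only [Cond.Holds, ha] at he
    rw [succT, eval_app (a := ![b]) (Fin.forall_fin_one.2 hb)] at he
    exact ((hA.static_spec .succ _ _ (by simp) (by simp)).1 he.symm).symm

theorem hasVal_predT (hs : HasVal A e s (x + 1)) : HasVal A e (predT s) x := by
  have hlt := hs.lt
  obtain ⟨a, ha, hx⟩ := hs
  refine ⟨⟨x, by omega⟩, ?_, rfl⟩
  rw [predT, eval_app (a := ![a]) (Fin.forall_fin_one.2 ha)]
  exact (hA.static_spec .pred _ _ (by simp) (by simp)).2 hx.symm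

theorem hasVal_lastT (hn : 0 < n) : HasVal A e lastT (n - 1) := by
  refine ⟨⟨n - 1, by omega⟩, ?_, rfl⟩
  rw [lastT, eval_app (a := ![]) (fun i => i.elim0)]
  exact (hA.static_spec .last _ _ (by simp) (by simp)).2 (Nat.sub_add_cancel hn)

theorem hasVal_topT (hn : 0 < n) : HasVal A e topT (top n) := by
  refine ⟨⟨top n, top_lt hn⟩, ?_, rfl⟩
  rw [topT, eval_app (a := ![]) (fun i => i.elim0)]
  exact (hA.static_spec .top _ _ (by simp) (by simp)).2 rfl

theorem hasVal_depthT (hs : HasVal A e s x) (ht : HasVal A e t y) (hx : x ≤ top n)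
    (hy : blockStart x y = y) : HasVal A e (depthT s t) (depth (height w) n x y) := by
  obtain ⟨a, ha, rfl⟩ := hs
  obtain ⟨b, hb, rfl⟩ := ht
  obtain ⟨d, hd, he⟩ := hA.depth_spec ![a, b] hx hy
  refine ⟨d, ?_, he⟩
  rw [depthT, eval_app (a := ![a, b]) (Fin.forall_fin_two.2 ⟨ha, hb⟩), hd]

theorem hasVal_countT (σ : DyckStep) (hs : HasVal A e s x) (ht : HasVal A e t y) (hx : x < top n)
    (hy : blockStart x y = y) : HasVal A e (countT σ s t)
      (count w σ y - count w σ (blockStart (x + 1) y)) := by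
  obtain ⟨a, ha, rfl⟩ := hs
  obtain ⟨b, hb, rfl⟩ := ht
  obtain ⟨d, hd, he⟩ := hA.count_spec σ ![a, b] hx hy
  refine ⟨d, ?_, he⟩
  rw [countT, eval_app (a := ![a, b]) (Fin.forall_fin_two.2 ⟨ha, hb⟩), hd]

theorem holds_letterC_iff {σ : DyckStep} (hs : HasVal A e s x) :
    (letterC σ s).Holds A e ↔ letter w x = some σ := by
  obtain ⟨a, ha, rfl⟩ := hs
  simp only [letterC, Cond.Holds, letter_coe]
  constructor
  · rintro ⟨v, hv, hr⟩
    have : v 0 = a := Option.some_inj.1 ((hv 0).symm.trans ha)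
    exact this ▸ (hA.letter_spec σ v).1 hr
  · exact fun h => ⟨![a], Fin.forall_fin_one.2 ha, (hA.letter_spec σ _).2 h⟩

/-- By `count_add_depth_lt` both sums stay inside the domain, so the equality compares numbers and
never two undefined values. -/
theorem holds_lowC_iff {p : ℕ} (hn : 0 < n) (hs : HasVal A e s x) (ht : HasVal A e t y)
    (hu : HasVal A e u p) (hx : x < top n) (hy : blockStart x y = y)
    (hyp : blockStart (x + 1) y = blockStart (x + 1) p) :
    (lowC s t u).Holds A e ↔
      blockMin (height w) n x y = blockMin (height w) n (x + 1) y := by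
  have htop := top_lt hn
  obtain ⟨h₁, h₂⟩ := count_add_depth_lt (w := w) ht.lt hy
  have hsucc := hA.hasVal_succT hs (by omega)
  rw [lowC, holds_eq_iff ((hA.hasVal_countT .U hs ht hx hy).add ((hA.hasVal_depthT hsucc
      ((hA.hasVal_startT hsucc hu).congr hyp.symm) hx (by simp))) h₁)
    ((hA.hasVal_countT .D hs ht hx hy).add (hA.hasVal_depthT hs ht hx.le hy) h₂),
    blockMin_eq_iff_count ht.lt]

end Stores

@[simp] theorem extend_two (a b c : Fin n) : extend ![a, b] c = ![a, b, c] := by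
  ext i; fin_cases i <;> rfl

@[simp] theorem extend_three (a b c d : Fin n) : extend ![a, b, c] d = ![a, b, c, d] := by
  ext i; fin_cases i <;> rfl

-- Meaning of the attainment tests and of the query

namespace Stores

variable {w : Fin n → Option DyckStep}

/-- `hs` requires the side condition to imply that the child exists. Bounding the searches by
`levels` loses nothing: y and x are below z ≤ top n, and child indices are at most y + 1 ≤ z. -/
theorem holds_attainC_iff (hA : Stores A w) (p z : Fin n) (hz : (z : ℕ) ≤ top n)
    {s : Cond dyckSchema 4} {t : ℕ → ℕ → Prop}
    (hs : ∀ y i : Fin n, s.Holds A ![p, z, y, i] ↔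
      ∃ c, HasVal A ![p, z, y, i] (childT (.var 2) (.var 0) (.var 3)) c ∧ t y c) :
    (attainC s).Holds A ![p, z] ↔ ∃ y < (z : ℕ), ∃ c < n,
      (blockStart y c = c ∧ blockStart (y + 1) c = blockStart (y + 1) p) ∧ t y c ∧
      blockMin (height w) n y c = blockMin (height w) n (y + 1) c ∧
      ∀ x < (z : ℕ), y < x → blockMin (height w) n x p = blockMin (height w) n (x + 1) p := by
  have hn : 0 < n := (Nat.zero_le _).trans_lt p.2
  have htop := top_lt hn
  have h0 : ∀ y i : Fin n, HasVal A ![p, z, y, i] (.var 0) p := fun y i => hasVal_var 0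
  have h1 : ∀ y i : Fin n, HasVal A ![p, z, y, i] (.var 1) z := fun y i => hasVal_var 1
  have h2 : ∀ y i : Fin n, HasVal A ![p, z, y, i] (.var 2) y := fun y i => hasVal_var 2
  have h3 : ∀ y i : Fin n, HasVal A ![p, z, y, i] (.var 3) i := fun y i => hasVal_var 3
  have hlt : ∀ y : Fin n, (ltC (.var 2) (.var 1) : Cond dyckSchema 3).Holds A ![p, z, y] ↔ y < z :=
    fun y => holds_ltC_iff (hasVal_var 2) (hasVal_var 1)
  have hpath : ∀ y x : Fin n, (x : ℕ) < top n →
      ((lowC (.var 3) (startT (.var 3) (.var 0)) (.var 0)).Holds A ![p, z, y, x] ↔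
        blockMin (height w) n x p = blockMin (height w) n (x + 1) p) := fun y x hx => by
    have hx' := blockStart_succ_congr (blockStart_blockStart x p)
    rw [hA.holds_lowC_iff hn (h3 y x) (hA.hasVal_startT (h3 y x) (h0 y x)) (h0 y x) hx (by simp) hx',
      blockMin_congr (blockStart_blockStart x p), blockMin_congr hx']
  have hchild : ∀ y i : Fin n, (y : ℕ) < z → ∀ c,
      HasVal A ![p, z, y, i] (childT (.var 2) (.var 0) (.var 3)) c →
      ((lowC (.var 2) (childT (.var 2) (.var 0) (.var 3)) (.var 0)).Holds A ![p, z, y, i] ↔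
        blockMin (height w) n y c = blockMin (height w) n (y + 1) c) ∧ IsChild y p i c ∧
        blockStart y c = c := fun y i hy c hc => by
    have := (hA.isChild_of_hasVal (h2 y i) (h0 y i) (h3 y i) hc).2
    have hst : blockStart y c = c := by
      have : blockLen y ∣ c := by
        rw [this.1]
        exact dvd_add ((blockLen_dvd_succ y).mul_left _) (dvd_mul_left _ _)
      exact Nat.div_mul_cancel this
    exact ⟨hA.holds_lowC_iff hn (h2 y i) hc (h0 y i) (by omega) hst this.2, this, hst⟩
  rw [attainC, holds_ex_iff]
  simp only [extend_two, extend_three, holds_and_iff, holds_not_iff, holds_ex_iff, hs, hlt,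
    holds_ltC_iff (h2 _ _) (h3 _ _), holds_ltC_iff (h3 _ _) (h1 _ _)]
  constructor
  · rintro ⟨y, -, hyz, ⟨i, -, ⟨c, hc, ht⟩, hlow⟩, hx⟩
    obtain ⟨hl, hch, hst⟩ := hchild y i hyz c hc
    refine ⟨y, hyz, c, hc.lt, ⟨hst, hch.2⟩, ht, hl.1 hlow, fun x hxz hyx => ?_⟩
    by_contra h
    have hxn : x < n := by omega
    exact hx ⟨⟨x, hxn⟩, by simp only; omega, hyx, hxz, fun h' => h ((hpath y ⟨x, hxn⟩ (by simp only; omega)).1 h')⟩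
  · rintro ⟨y, hyz, c, hc, hcs, ht, hlow, hx⟩
    obtain ⟨i, hi, hch⟩ := exists_isChild_iff.2 hcs
    have hval := hA.hasVal_childT (h2 ⟨y, by omega⟩ ⟨i, by omega⟩) (h0 _ _) (h3 _ _)
      (by simp only; omega) hc hch
    refine ⟨⟨y, by omega⟩, by simp only; omega, hyz, ⟨⟨i, by omega⟩, by simp only; omega,
      ⟨c, hval, ht⟩, (hchild _ _ hyz c hval).1.2 hlow⟩, ?_⟩
    rintro ⟨x, -, hyx, hxz, hno⟩
    exact hno ((hpath _ x (by omega)).2 (hx x hxz hyx))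

theorem holds_attainLtC_iff (hA : Stores A w) (p z : Fin n) (hz : (z : ℕ) ≤ top n)
    (hz' : 0 < (z : ℕ)) : attainLtC.Holds A ![p, z] ↔ ∃ q < n, q < (p : ℕ) ∧
      blockStart z q = blockStart z p ∧ height w q = blockMin (height w) n z p := by
  rw [exists_lt_eq_blockMin_iff p.2 hz']
  refine hA.holds_attainC_iff p z hz (t := fun y c => c < blockStart y p) fun y i => ?_
  have hst : HasVal A ![p, z, y, i] (startT (.var 2) (.var 0)) (blockStart y p) :=
    hA.hasVal_startT (hasVal_var 2) (hasVal_var 0)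
  constructor
  · intro h
    have h' := h
    rw [ltC, holds_and_iff] at h'
    simp only [Cond.Holds] at h'
    obtain ⟨⟨c, -, hc, -⟩, -⟩ := h'
    exact ⟨c, ⟨c, hc, rfl⟩, (holds_ltC_iff ⟨c, hc, rfl⟩ hst).1 h⟩
  · rintro ⟨c, hc, h⟩
    exact (holds_ltC_iff hc hst).2 h

theorem holds_attainGeC_iff (hA : Stores A w) (p z : Fin n) (hz : (z : ℕ) ≤ top n)
    (hz' : 0 < (z : ℕ)) : attainGeC.Holds A ![p, z] ↔ ∃ q < n, (p : ℕ) ≤ q ∧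
      blockStart z q = blockStart z p ∧ height w q = blockMin (height w) n z p := by
  rw [exists_ge_eq_blockMin_iff p.2 hz']
  refine hA.holds_attainC_iff p z hz (t := fun _ c => p ≤ c) fun y i => ?_
  have hp : HasVal A ![p, z, y, i] (.var 0) p := hasVal_var 0
  constructor
  · intro h
    have h' := h
    simp only [Cond.Holds] at h'
    obtain ⟨-, c, -, hc, -⟩ := h'
    exact ⟨c, ⟨c, hc, rfl⟩, (holds_le_iff hp ⟨c, hc, rfl⟩).1 h⟩
  · rintro ⟨c, hc, h⟩
    exact (holds_le_iff hp hc).2 h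

/-- The query is answered correctly. -/
theorem holds_queryC_iff (hA : Stores A w) (e : Fin 0 → Fin n) (hn : 0 < n) :
    queryC.Holds A e ↔ (List.ofFn w).reduceOption ∈ dyckLanguage := by
  have htop := top_lt hn
  have hz : HasVal A e (startT topT lastT) 0 :=
    (hA.hasVal_startT (hA.hasVal_topT hn) (hA.hasVal_lastT hn)).congr (blockStart_top (by omega))
  have hd := hA.hasVal_depthT (hA.hasVal_topT hn) hz le_rfl (blockStart_top hn)
  have hlow : ∀ x : Fin n, (x : ℕ) < top n →
      ((lowC (.var 0) (startT (.var 0) lastT) lastT).Holds A (extend e x) ↔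
        blockMin (height w) n x (n - 1) = blockMin (height w) n (x + 1) (n - 1)) := fun x hx => by
    have hx' := blockStart_succ_congr (blockStart_blockStart x (n - 1))
    have h0 : HasVal A (extend e x) (.var 0) x := hasVal_var 0
    rw [hA.holds_lowC_iff hn h0 (hA.hasVal_startT h0 (hA.hasVal_lastT hn)) (hA.hasVal_lastT hn) hx
      (by simp) hx', blockMin_congr (blockStart_blockStart x (n - 1)), blockMin_congr hx']
  have hlt : ∀ x : Fin n, (ltC (.var 0) topT).Holds A (extend e x) ↔ (x : ℕ) < top n := fun x =>
    holds_ltC_iff (hasVal_var 0) (hA.hasVal_topT hn)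
  have hlast : (¬ ∃ x : Fin n, (x : ℕ) ≤ top n ∧ (x : ℕ) < top n ∧
      ¬ (lowC (.var 0) (startT (.var 0) lastT) lastT).Holds A (extend e x)) ↔
      height w (n - 1) = blockMin (height w) n (top n) (n - 1) := by
    rw [eq_blockMin_iff (by omega)]
    constructor
    · intro h x hx
      by_contra hne
      have hxn : x < n := by omega
      exact h ⟨⟨x, hxn⟩, hx.le, hx, fun h' => hne ((hlow ⟨x, hxn⟩ hx).1 h')⟩
    · rintro h ⟨x, -, hx, hno⟩
      exact hno ((hlow x hx).2 (h x hx))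
  have hmin : blockMin (height w) n (top n) (n - 1) = blockMin (height w) n (top n) 0 :=
    blockMin_congr (by rw [blockStart_top (by omega), blockStart_top hn])
  have hdep := coe_depth (h := height w) (z := top n) hn
  -- The depth of the top block is h(0) minus the minimum, and h(0) is read off from the first
  -- letter. A closing parenthesis there makes the minimum negative, so that case has no disjunct.
  have hzero : (((letter w 0 = some .U ∧ depth (height w) n (top n) 0 = 0 + 1) ∨
      ¬ (letter w 0 = some .U ∨ letter w 0 = some .D) ∧
        depth (height w) n (top n) 0 = 0)) ↔ blockMin (height w) n (top n) 0 = 0 := by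
    have h0 : height w 0 = (if letter w 0 = some .U then 1 else 0) -
        if letter w 0 = some .D then 1 else 0 := by
      simp [height, count, Nat.count_succ]
    have hle := blockMin_le (h := height w) (z := top n) hn rfl
    rcases h : letter w 0 with _ | _ | _ <;> simp [h] at h0 ⊢ <;> omega
  rw [queryC, holds_and_iff, holds_not_iff, holds_ex_iff]
  simp only [holds_and_iff, holds_or_iff, holds_not_iff, hlt, hA.holds_letterC_iff hz,
    hA.holds_eq_succT_iff hd hz, holds_eq_iff hd hz]
  rw [hlast, hzero, word_mem_dyckLanguage_iff w hn, hmin]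
  constructor
  · rintro ⟨h₁, h₂⟩
    refine ⟨h₁.trans h₂, fun q hq => ?_⟩
    rw [← h₂]
    exact blockMin_le hq (by rw [blockStart_top hq, blockStart_top hn])
  · rintro ⟨h₁, h₂⟩
    have : blockMin (height w) n (top n) 0 = 0 := by
      rw [blockMin_eq (q := n - 1) (by omega)
        (by rw [blockStart_top (show n - 1 < n by omega), blockStart_top hn])
        fun r hr _ => h₁ ▸ h₂ r hr, h₁]
    exact ⟨h₁.trans this.symm, this⟩

end Stores

end Eval

/-! ### Safety: no term of the program contains a search -/

section Safety

variable {n k : ℕ} {A : Str dyckSchema n} {e : Fin k → Fin n} {s t u : Term dyckSchema k}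

theorem safe_countT (σ : DyckStep) (hs : s.Safe A e) (ht : t.Safe A e) :
    (countT σ s t).Safe A e := by
  simp only [countT, Term.Safe]
  exact Fin.forall_fin_two.2 ⟨hs, ht⟩

theorem safe_depthT (hs : s.Safe A e) (ht : t.Safe A e) : (depthT s t).Safe A e := by
  simp only [depthT, Term.Safe]
  exact Fin.forall_fin_two.2 ⟨hs, ht⟩

theorem safe_startT (hs : s.Safe A e) (ht : t.Safe A e) : (startT s t).Safe A e := by
  simp only [startT, Term.Safe]
  exact Fin.forall_fin_two.2 ⟨hs, ht⟩

theorem safe_childT (hs : s.Safe A e) (ht : t.Safe A e) (hu : u.Safe A e) :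
    (childT s t u).Safe A e := by
  simp only [childT, Term.Safe]
  exact Fin.forall_fin_succ.2 ⟨hs, Fin.forall_fin_two.2 ⟨ht, hu⟩⟩

theorem safe_succT (hs : s.Safe A e) : (succT s).Safe A e := by
  simp only [succT, Term.Safe]
  exact Fin.forall_fin_one.2 hs

theorem safe_predT (hs : s.Safe A e) : (predT s).Safe A e := by
  simp only [predT, Term.Safe]
  exact Fin.forall_fin_one.2 hs

theorem safe_lastT : (lastT : Term dyckSchema k).Safe A e := by
  simp only [lastT, Term.Safe]
  exact fun i => i.elim0

theorem safe_topT : (topT : Term dyckSchema k).Safe A e := by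
  simp only [topT, Term.Safe]
  exact fun i => i.elim0

theorem safe_letterC (σ : DyckStep) (hs : s.Safe A e) : (letterC σ s).Safe A e := by
  simp only [letterC, Cond.Safe]
  exact Fin.forall_fin_one.2 hs

theorem safe_ltC (hs : s.Safe A e) (ht : t.Safe A e) : (ltC s t).Safe A e := by
  simp only [ltC, Cond.Safe]
  exact ⟨⟨hs, ht⟩, hs, ht⟩

theorem safe_falseC : (falseC : Cond dyckSchema k).Safe A e := by
  simp [falseC, Cond.Safe, Term.Safe]

theorem safe_lowC (hs : s.Safe A e) (ht : t.Safe A e) (hu : u.Safe A e) :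
    (lowC s t u).Safe A e := by
  simp only [lowC, Cond.Safe, Term.Safe]
  exact ⟨⟨safe_countT _ hs ht, safe_depthT (safe_succT hs) (safe_startT (safe_succT hs) hu)⟩,
    safe_countT _ hs ht, safe_depthT hs ht⟩

theorem safe_var (i : Fin k) : (Term.var i : Term dyckSchema k).Safe A e := by
  simp only [Term.Safe]

theorem safe_attainC {c : Cond dyckSchema 4} (hc : ∀ e : Fin 4 → Fin n, c.Safe A e)
    (e : Fin 2 → Fin n) : (attainC c).Safe A e := by
  simp only [attainC, Cond.Safe]
  exact fun _ _ => ⟨safe_ltC (safe_var _) (safe_var _),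
    fun _ _ => ⟨hc _, safe_lowC (safe_var _) (safe_childT (safe_var _) (safe_var _) (safe_var _))
      (safe_var _)⟩,
    fun _ _ => ⟨safe_ltC (safe_var _) (safe_var _), safe_ltC (safe_var _) (safe_var _),
      safe_lowC (safe_var _) (safe_startT (safe_var _) (safe_var _)) (safe_var _)⟩⟩

theorem safe_attainLtC (e : Fin 2 → Fin n) : attainLtC.Safe A e :=
  safe_attainC (fun _ => safe_ltC (safe_childT (safe_var _) (safe_var _) (safe_var _))
    (safe_startT (safe_var _) (safe_var _))) e

theorem safe_attainGeC (e : Fin 2 → Fin n) : attainGeC.Safe A e := by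
  refine safe_attainC (fun _ => ?_) e
  simp only [Cond.Safe]
  exact ⟨safe_var _, safe_childT (safe_var _) (safe_var _) (safe_var _)⟩

theorem safe_addsC (δ : WordChange DyckStep) (σ : DyckStep) (hs : s.Safe A e) :
    (addsC δ σ s).Safe A e := by
  unfold addsC
  split
  · split
    · simp only [Cond.Safe]
      exact ⟨safe_letterC _ hs, safe_letterC _ hs⟩
    · exact safe_falseC
  · exact safe_falseC

theorem safe_removesC (δ : WordChange DyckStep) (σ : DyckStep) (hs : s.Safe A e) :
    (removesC δ σ s).Safe A e := by
  unfold removesC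
  split
  · exact safe_falseC
  · exact safe_letterC _ hs

theorem safe_depthBody (δ : WordChange DyckStep) (e : Fin 2 → Fin n) :
    (depthBody δ).Safe A e := by
  have hst : (startT (.var 1) (.var 0) : Term dyckSchema 2).Safe A e :=
    safe_startT (safe_var _) (safe_var _)
  have hd : (depthT (.var 1) (startT (.var 1) (.var 0)) : Term dyckSchema 2).Safe A e :=
    safe_depthT (safe_var _) hst
  have ha := fun σ => safe_addsC δ σ (safe_var (A := A) (e := e) 0)
  have hr := fun σ => safe_removesC δ σ (safe_var (A := A) (e := e) 0)
  simp only [depthBody, Term.Safe, Cond.Safe]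
  exact ⟨⟨hst, trivial⟩, fun _ => hd, fun _ => ⟨⟨ha _, hr _⟩, fun _ => ⟨safe_attainLtC _,
    fun _ => hd, fun _ => safe_predT hd⟩, fun _ => ⟨⟨ha _, hr _⟩, fun _ => ⟨safe_attainGeC _,
      fun _ => safe_succT hd, fun _ => hd⟩, fun _ => hd⟩⟩⟩

theorem safe_countBody (δ : WordChange DyckStep) (σ : DyckStep) (e : Fin 3 → Fin n) :
    (countBody δ σ).Safe A e := by
  have hc : (childT (.var 1) (.var 0) (.var 2) : Term dyckSchema 3).Safe A e :=
    safe_childT (safe_var _) (safe_var _) (safe_var _)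
  have hd := safe_countT σ (safe_var (A := A) (e := e) 1) hc
  simp only [countBody, Term.Safe, Cond.Safe]
  exact ⟨⟨⟨trivial, hc⟩, safe_startT (safe_succT (safe_var _)) (safe_var _), trivial⟩,
    fun _ => ⟨safe_addsC _ _ (safe_var _), fun _ => safe_succT hd, fun _ =>
      ⟨safe_removesC _ _ (safe_var _), fun _ => safe_predT hd, fun _ => hd⟩⟩, fun _ => hd⟩

theorem safe_queryC (e : Fin 0 → Fin n) : queryC.Safe A e := by
  have hz : (startT topT lastT : Term dyckSchema 0).Safe A e := safe_startT safe_topT safe_lastT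
  have hd := safe_depthT (safe_topT (A := A) (e := e)) hz
  simp only [queryC, Cond.Safe]
  exact ⟨fun _ _ => ⟨safe_ltC (safe_var _) safe_topT, safe_lowC (safe_var _)
    (safe_startT (safe_var _) safe_lastT) safe_lastT⟩,
    ⟨safe_letterC _ hz, hd, safe_succT hz⟩, ⟨safe_letterC _ hz, safe_letterC _ hz⟩, hd, hz⟩

theorem relSafe_letterRule (δ : WordChange DyckStep) (σ : DyckStep) (p : Fin 1 → Fin n) :
    (letterRule δ σ).RelSafe A p := by
  intro x _
  refine ⟨fun _ => safe_var _, ?_⟩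
  simp only [letterRule, Cond.Safe]
  exact ⟨⟨safe_letterC _ (safe_var _), safe_removesC _ _ (safe_var _)⟩,
    safe_addsC _ _ (safe_var _)⟩

end Safety

/-! ### Effect of a change -/

/-- The effect of a change on the letter at the changed position. -/
def newLetter (δ : WordChange DyckStep) (l : Option DyckStep) : Option DyckStep :=
  match δ with
  | .set σ => if l = none then some σ else l
  | .reset => none

theorem change_eq_update {n : ℕ} (δ : WordChange DyckStep) (p : Fin 1 → Fin n)
    (w : Fin n → Option DyckStep) :
    (memberProblem dyckLanguage).change δ p w =
      Function.update w (p 0) (newLetter δ (w (p 0))) := by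
  cases δ with
  | set σ =>
    by_cases h : w (p 0) = none
    · simp [memberProblem, newLetter, h]
    · simp [memberProblem, newLetter, h]
  | reset => rfl

/-- The change of the difference between opening and closing parentheses. -/
theorem newLetter_sub_eq_one (δ : WordChange DyckStep) (l : Option DyckStep)
    (h : l ≠ some .U ∧ newLetter δ l = some .U ∨ l = some .D ∧ newLetter δ l ≠ some .D) :
    (((if newLetter δ l = some .U then 1 else 0) - (if l = some .U then 1 else 0)) -
      ((if newLetter δ l = some .D then 1 else 0) - (if l = some .D then 1 else 0)) : ℤ) = 1 := by
  revert h
  rcases δ with (_ | _) | _ <;> rcases l with _ | _ | _ <;> simp [newLetter]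

theorem newLetter_sub_eq_neg_one (δ : WordChange DyckStep) (l : Option DyckStep)
    (h : l ≠ some .D ∧ newLetter δ l = some .D ∨ l = some .U ∧ newLetter δ l ≠ some .U) :
    (((if newLetter δ l = some .U then 1 else 0) - (if l = some .U then 1 else 0)) -
      ((if newLetter δ l = some .D then 1 else 0) - (if l = some .D then 1 else 0)) : ℤ) = -1 := by
  revert h
  rcases δ with (_ | _) | _ <;> rcases l with _ | _ | _ <;> simp [newLetter]

theorem newLetter_sub_eq_zero (δ : WordChange DyckStep) (l : Option DyckStep)
    (h : ¬ (l ≠ some .U ∧ newLetter δ l = some .U ∨ l = some .D ∧ newLetter δ l ≠ some .D))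
    (h' : ¬ (l ≠ some .D ∧ newLetter δ l = some .D ∨ l = some .U ∧ newLetter δ l ≠ some .U)) :
    (((if newLetter δ l = some .U then 1 else 0) - (if l = some .U then 1 else 0)) -
      ((if newLetter δ l = some .D then 1 else 0) - (if l = some .D then 1 else 0)) : ℤ) = 0 := by
  revert h h'
  rcases δ with (_ | _) | _ <;> rcases l with _ | _ | _ <;> simp [newLetter]

section Step

variable {n k : ℕ} {A : Str dyckSchema n} {e : Fin k → Fin n} {w : Fin n → Option DyckStep}
  (hA : Stores A w) (δ : WordChange DyckStep) (σ : DyckStep)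

include hA

theorem Stores.holds_addsC_iff {t : Term dyckSchema k} {p : Fin n} (ht : HasVal A e t p) :
    (addsC δ σ t).Holds A e ↔ w p ≠ some σ ∧ newLetter δ (w p) = some σ := by
  cases δ with
  | set τ =>
    by_cases h : τ = σ
    · subst h
      simp only [addsC, if_true, holds_not_iff, holds_or_iff, hA.holds_letterC_iff ht, letter_coe,
        newLetter]
      rcases w p with _ | _ | _ <;> simp
    · simp only [addsC, if_neg h, not_holds_falseC, newLetter, false_iff]
      rcases w p with _ | _ <;> simp [h]
  | reset => simp [addsC, not_holds_falseC, newLetter]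

theorem Stores.holds_removesC_iff {t : Term dyckSchema k} {p : Fin n} (ht : HasVal A e t p) :
    (removesC δ σ t).Holds A e ↔ w p = some σ ∧ newLetter δ (w p) ≠ some σ := by
  cases δ with
  | set τ =>
    simp only [removesC, not_holds_falseC, newLetter, false_iff]
    rcases w p with _ | _ <;> simp
  | reset => simp [removesC, hA.holds_letterC_iff ht, newLetter]

omit hA

theorem height_update (p : Fin n) (l : Option DyckStep) (q : ℕ) :
    height (Function.update w p l) q = height w q + if (p : ℕ) ≤ q then
      ((if l = some .U then 1 else 0) - (if w p = some .U then 1 else 0)) -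
        ((if l = some .D then 1 else 0) - (if w p = some .D then 1 else 0)) else 0 := by
  rw [height, height, count_update, count_update]
  split <;> ring

include hA

theorem Stores.hasVal_depthBody (p z : Fin n) (hz : (z : ℕ) ≤ top n) :
    HasVal A ![p, z] (depthBody δ)
      (depth (height (Function.update w p (newLetter δ (w p)))) n z (blockStart z p)) := by
  set w' := Function.update w p (newLetter δ (w p)) with hw'
  have hp : HasVal A ![p, z] (.var 0) p := hasVal_var 0
  have hst : HasVal A ![p, z] (startT (.var 1) (.var 0)) (blockStart z p) :=
    hA.hasVal_startT (hasVal_var 1) hp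
  have hd := hA.hasVal_depthT (hasVal_var (A := A) (e := ![p, z]) 1) hst hz (by simp)
  change HasVal A ![p, z] _ (depth (height w) n z _) at hd
  have hh := fun q => height_update (w := w) p (newLetter δ (w p)) q
  rw [← hw'] at hh
  have hlt : blockStart z p < n := hst.lt
  -- The new depth is below n, so the successor in `depthBody` is defined when it is needed.
  have hlt' : depth (height w') n z (blockStart z p) < n := depth_lt w' hlt (by simp)
  -- The attainment tests are characterised only above level 0, where every position starts its own
  -- block and the first branch applies.
  have hpos : blockStart z p ≠ (p : ℕ) → 0 < (z : ℕ) := fun h => by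
    by_contra h0
    rw [Nat.eq_zero_of_not_pos h0, blockStart_zero] at h
    exact h rfl
  refine HasVal.ite (fun h => ?_) (fun h => ?_)
  · rw [holds_eq_iff hst hp] at h
    rw [depth_eq_of_ne hh hlt (by simp) (.inr h.symm)]
    exact hd
  rw [holds_eq_iff hst hp] at h
  refine HasVal.ite (fun hup => ?_) (fun hup => ?_)
  · rw [holds_or_iff, hA.holds_addsC_iff δ _ hp, hA.holds_removesC_iff δ _ hp] at hup
    have hh' : ∀ q, height w' q = height w q + if (p : ℕ) ≤ q then 1 else 0 := fun q => by
      rw [hh, newLetter_sub_eq_one _ _ hup]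
    refine HasVal.ite (fun hat => ?_) (fun hat => ?_)
    · rw [hA.holds_attainLtC_iff p z hz (hpos h)] at hat
      rw [depth_eq_of_exists_lt hh' h hat]
      exact hd
    · rw [hA.holds_attainLtC_iff p z hz (hpos h)] at hat
      rw [← depth_add_one_of_not_exists_lt hh' p.2 h hat] at hd
      exact hA.hasVal_predT hd
  refine HasVal.ite (fun hdn => ?_) (fun hdn => ?_)
  · rw [holds_or_iff, hA.holds_addsC_iff δ _ hp, hA.holds_removesC_iff δ _ hp] at hdn
    have hh' : ∀ q, height w' q = height w q + if (p : ℕ) ≤ q then -1 else 0 := fun q => by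
      rw [hh, newLetter_sub_eq_neg_one _ _ hdn]
    refine HasVal.ite (fun hat => ?_) (fun hat => ?_)
    · rw [hA.holds_attainGeC_iff p z hz (hpos h)] at hat
      rw [depth_eq_add_one_of_exists_ge hh' p.2 h hat] at hlt' ⊢
      exact hA.hasVal_succT hd hlt'
    · rw [hA.holds_attainGeC_iff p z hz (hpos h)] at hat
      rw [depth_eq_of_not_exists_ge hh' p.2 h hat]
      exact hd
  · rw [holds_or_iff, hA.holds_addsC_iff δ _ hp, hA.holds_removesC_iff δ _ hp] at hup hdn
    have hh' : height w' = height w := funext fun q => by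
      rw [hh, newLetter_sub_eq_zero _ _ hup hdn, ite_self, add_zero]
    rw [hh']
    exact hd

/-- The count refers to (a, c], where a is the start of the block of p at level z + 1. As a ≤ p
always holds, the letter at p is counted iff p ≠ a and p ≤ c. -/
theorem Stores.hasVal_countBody (p z i : Fin n) {c : ℕ}
    (hc : HasVal A ![p, z, i] (childT (.var 1) (.var 0) (.var 2)) c) :
    HasVal A ![p, z, i] (countBody δ σ)
      (count (Function.update w p (newLetter δ (w p))) σ c -
        count (Function.update w p (newLetter δ (w p))) σ (blockStart (z + 1) c)) := by
  set w' := Function.update w p (newLetter δ (w p)) with hw'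
  have hn : 0 < n := (Nat.zero_le _).trans_lt p.2
  have htop := top_lt hn
  have hp : HasVal A ![p, z, i] (.var 0) p := hasVal_var 0
  have hz : HasVal A ![p, z, i] (.var 1) z := hasVal_var 1
  have hi : HasVal A ![p, z, i] (.var 2) i := hasVal_var 2
  obtain ⟨hzt, hch⟩ := hA.isChild_of_hasVal hz hp hi hc
  have hcs : blockStart z c = c := by
    have : blockLen z ∣ c := by
      rw [hch.1]
      exact dvd_add ((blockLen_dvd_succ z).mul_left _) (dvd_mul_left _ _)
    exact Nat.div_mul_cancel this
  have hd := hA.hasVal_countT σ hz hc hzt hcs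
  have hst : HasVal A ![p, z, i] (startT (succT (.var 1)) (.var 0)) (blockStart (z + 1) p) :=
    hA.hasVal_startT (hA.hasVal_succT hz (by omega)) hp
  have hcount := fun q => count_update w p (newLetter δ (w p)) σ q
  rw [← hw'] at hcount
  have h₁ := hcount c
  have h₂ := hcount (blockStart (z + 1) c)
  have hle := blockStart_le (z + 1) c
  have hm := count_mono w σ hle
  have hm' := count_mono w' σ hle
  have hsp := blockStart_le (z + 1) p
  have hlt : count w' σ c - count w' σ (blockStart (z + 1) c) < n :=
    (Nat.sub_le_sub_right (show count w' σ c ≤ count w' σ c from le_rfl) _).trans_lt (by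
      have := count_add_count_le w' hle
      have := count_mono w' .U hle
      have := count_mono w' .D hle
      have := hc.lt
      cases σ <;> omega)
  rw [hch.2] at h₂ hm hm' hle hlt hd ⊢
  refine HasVal.ite (fun h => ?_) (fun h => ?_)
  · rw [holds_and_iff, holds_not_iff, holds_le_iff hp hc, holds_eq_iff hst hp] at h
    rw [if_pos h.1] at h₁
    rw [if_neg (by omega)] at h₂
    refine HasVal.ite (fun ha => ?_) (fun ha => ?_)
    · rw [hA.holds_addsC_iff δ _ hp] at ha
      rw [if_pos ha.2, if_neg ha.1] at h₁
      have he : count w σ c - count w σ (blockStart (z + 1) p) + 1 =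
        count w' σ c - count w' σ (blockStart (z + 1) p) := by omega
      exact (hA.hasVal_succT hd (by omega)).congr he
    rw [hA.holds_addsC_iff δ _ hp] at ha
    refine HasVal.ite (fun hr => ?_) (fun hr => ?_)
    · rw [hA.holds_removesC_iff δ _ hp] at hr
      rw [if_neg hr.2, if_pos hr.1] at h₁
      exact hA.hasVal_predT (hd.congr (by omega))
    · rw [hA.holds_removesC_iff δ _ hp] at hr
      refine hd.congr ?_
      by_cases hw : w p = some σ
      · rw [if_pos (by tauto), if_pos hw] at h₁
        omega
      · rw [if_neg (by tauto), if_neg hw] at h₁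
        omega
  · rw [holds_and_iff, holds_not_iff, holds_le_iff hp hc, holds_eq_iff hst hp] at h
    refine hd.congr ?_
    by_cases hpc : (p : ℕ) ≤ c
    · rw [if_pos hpc] at h₁
      -- Here p is the start of the surrounding block, so both prefix counts change alike.
      rw [if_pos (by omega)] at h₂
      omega
    · rw [if_neg hpc] at h₁
      rw [if_neg (by omega)] at h₂
      omega

end Step

/-! ### The rules maintain the invariant -/

section Maintenance

variable {n : ℕ} {A : Str dyckSchema n} {w : Fin n → Option DyckStep}
  (δ : WordChange DyckStep) (σ : DyckStep) (p : Fin 1 → Fin n)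

theorem newFunc_eq_of_addresses {m : ℕ} {π : UpdateRule dyckSchema 1 m (Term dyckSchema)}
    (hs : π.FuncSafe A p) {x : Fin π.vars → Fin n} {b : Fin m → Fin n}
    (hx : π.Addresses A p x b) (old : (Fin m → Fin n) → Option (Fin n)) :
    π.newFunc A p old b = π.body.eval A (Fin.append p x) := by
  have h : ∃ x, π.Addresses A p x b := ⟨x, hx⟩
  rw [UpdateRule.newFunc, dif_pos h]
  exact hs.2 _ _ b h.choose_spec hx

theorem newFunc_eq_of_not_addresses {m : ℕ} {π : UpdateRule dyckSchema 1 m (Term dyckSchema)}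
    {b : Fin m → Fin n} (h : ¬ ∃ x, π.Addresses A p x b)
    (old : (Fin m → Fin n) → Option (Fin n)) : π.newFunc A p old b = old b := by
  rw [UpdateRule.newFunc, dif_neg h]

theorem funcSafe_staticRule (f : DyckFunc) : (staticRule f).FuncSafe A p := by
  refine ⟨fun x _ => ⟨fun _ => ?_, ?_⟩, fun x y b _ _ => ?_⟩
  · simp only [staticRule, Term.Safe]
  · simp only [staticRule, Term.Safe, implies_true]
  · rw [show x = y from funext fun i => Fin.elim0 i]

/-- An undefined target addresses nothing if the arity is positive. For arity 0 the empty tuple is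
addressed, and the body returns its old value. -/
theorem newFunc_staticRule (f : DyckFunc) : (staticRule f).newFunc A p (A.func f) = A.func f := by
  funext b
  by_cases h : ∃ x, (staticRule f).Addresses A p x b
  · obtain ⟨x, hx⟩ := h
    rw [newFunc_eq_of_addresses p (funcSafe_staticRule p f) hx]
    refine eval_app fun i => ?_
    simpa only [staticRule] using hx.2 i
  · exact newFunc_eq_of_not_addresses p h _

theorem append_one_one (x : Fin 1 → Fin n) : Fin.append p x = ![p 0, x 0] := by
  ext i; fin_cases i <;> rfl

theorem append_one_two (x : Fin 2 → Fin n) : Fin.append p x = ![p 0, x 0, x 1] := by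
  ext i; fin_cases i <;> rfl

theorem newRel_letterRule (hA : Stores A w) (b : Fin 1 → Fin n) :
    (letterRule δ σ).newRel A p (A.rel σ) b ↔
      Function.update w (p 0) (newLetter δ (w (p 0))) (b 0) = some σ := by
  have hvar : ∀ x : Fin 0 → Fin n, HasVal A (Fin.append p x) (.var 0) (p 0) :=
    fun x => hasVal_var (A := A) (e := Fin.append p x) 0
  have haddr : ∀ x, (letterRule δ σ).Addresses A p x b ↔ p 0 = b 0 := by
    intro x
    have : (Term.var (τ := dyckSchema) (0 : Fin (1 + 0))).eval A (Fin.append p x) = some (p 0) := by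
      simp only [Term.eval]
      rfl
    refine ⟨fun h => ?_, fun h => ⟨fun i => Fin.elim0 i, Fin.forall_fin_one.2 ?_⟩⟩
    · exact Option.some_inj.1 (this.symm.trans (h.2 0))
    · exact this.trans (congrArg some h)
  have hbody : ∀ x, (letterRule δ σ).body.Holds A (Fin.append p x) ↔
      newLetter δ (w (p 0)) = some σ := by
    intro x
    have := hvar x
    refine (holds_or_iff.trans (or_congr (holds_and_iff.trans (and_congr
      (hA.holds_letterC_iff this) (holds_not_iff.trans (not_congr
        (hA.holds_removesC_iff δ σ this))))) (hA.holds_addsC_iff δ σ this))).trans ?_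
    rw [letter_coe]
    tauto
  simp only [UpdateRule.newRel, haddr, hbody]
  have hx : ∃ _x : Fin (letterRule δ σ).vars → Fin n, True := ⟨Fin.elim0, trivial⟩
  obtain ⟨x, -⟩ := hx
  rw [hA.letter_spec σ b, Function.update_apply]
  by_cases h : p 0 = b 0
  · rw [if_pos h.symm]
    exact ⟨fun h' => h'.elim (fun h' => absurd ⟨x, h⟩ h'.2) fun ⟨_, h'⟩ => h'.2,
      fun h' => .inr ⟨x, h, h'⟩⟩
  · rw [if_neg (Ne.symm h)]
    exact ⟨fun h' => h'.elim (fun h' => h'.1) fun ⟨_, h'⟩ => absurd h'.1 h,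
      fun h' => .inl ⟨h', fun ⟨_, h''⟩ => h h''⟩⟩

theorem Stores.addresses_depthRule_iff (hA : Stores A w) (x : Fin 1 → Fin n) (b : Fin 2 → Fin n) :
    (depthRule δ).Addresses A p x b ↔
      (x 0 : ℕ) ≤ top n ∧ x 0 = b 0 ∧ blockStart (x 0) (p 0) = b 1 := by
  have hz : HasVal A (Fin.append p x) (.var 1) (x 0) := hasVal_var (e := Fin.append p x) 1
  have h0 : HasVal A (Fin.append p x) (.var 0) (p 0) := hasVal_var (e := Fin.append p x) 0
  refine and_congr Fin.forall_fin_one (Fin.forall_fin_two.trans (and_congr ?_ ?_))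
  · obtain ⟨a, ha, hax⟩ := hz
    rw [← Fin.ext hax]
    exact (Eq.congr_left ha).trans Option.some_inj
  · obtain ⟨a, ha, hax⟩ := hA.hasVal_startT hz h0
    rw [← hax, ← Fin.ext_iff]
    exact (Eq.congr_left ha).trans Option.some_inj

theorem Stores.addresses_countRule_iff (hA : Stores A w) (x : Fin 2 → Fin n) (b : Fin 2 → Fin n) :
    (countRule δ σ).Addresses A p x b ↔ ((x 0 : ℕ) ≤ top n ∧ (x 1 : ℕ) ≤ top n) ∧ x 0 = b 0 ∧
      (x 0 : ℕ) < top n ∧ IsChild (x 0) (p 0) (x 1) (b 1) := by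
  have hz : HasVal A (Fin.append p x) (.var 1) (x 0) := hasVal_var (e := Fin.append p x) 1
  have h0 : HasVal A (Fin.append p x) (.var 0) (p 0) := hasVal_var (e := Fin.append p x) 0
  have hi : HasVal A (Fin.append p x) (.var 2) (x 1) := hasVal_var (e := Fin.append p x) 2
  refine and_congr Fin.forall_fin_two (Fin.forall_fin_two.trans (and_congr ?_ ⟨?_, ?_⟩))
  · obtain ⟨a, ha, hax⟩ := hz
    rw [← Fin.ext hax]
    exact (Eq.congr_left ha).trans Option.some_inj
  · exact fun h => hA.isChild_of_hasVal hz h0 hi ⟨b 1, h, rfl⟩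
  · rintro ⟨hx, hch⟩
    obtain ⟨c, hc, hcb⟩ := hA.hasVal_childT hz h0 hi hx (b 1).2 hch
    exact Fin.ext hcb ▸ hc

theorem Stores.funcSafe_depthRule (hA : Stores A w) : (depthRule δ).FuncSafe A p := by
  refine ⟨fun x _ => ⟨Fin.forall_fin_two.2 ⟨safe_var _, safe_startT (safe_var _) (safe_var _)⟩,
    safe_depthBody _ _⟩, fun x y b hx hy => ?_⟩
  have hx' := ((hA.addresses_depthRule_iff δ p x b).1 hx).2.1
  have hy' := ((hA.addresses_depthRule_iff δ p y b).1 hy).2.1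
  rw [show x = y from funext fun i => by
    rw [show i = (0 : Fin 1) from Subsingleton.elim (α := Fin 1) _ _]
    exact hx'.trans hy'.symm]

theorem Stores.hasVal_countRule (hA : Stores A w) {x b : Fin 2 → Fin n}
    (hx : (countRule δ σ).Addresses A p x b) :
    HasVal A (Fin.append p x) (countBody δ σ)
      (count (Function.update w (p 0) (newLetter δ (w (p 0)))) σ (b 1) -
        count (Function.update w (p 0) (newLetter δ (w (p 0)))) σ (blockStart (b 0 + 1) (b 1))) := by
  have hc := hx.2 1
  have hx' := ((hA.addresses_countRule_iff δ σ p x b).1 hx).2.1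
  have he : Fin.append p x = ![p 0, x 0, x 1] := append_one_two p x
  rw [← hx']
  refine he ▸ hA.hasVal_countBody δ σ (p 0) (x 0) (x 1) ⟨b 1, he ▸ hc, rfl⟩

/-- By `hasVal_countRule` the new value is determined by the addressed tuple alone. -/
theorem Stores.funcSafe_countRule (hA : Stores A w) : (countRule δ σ).FuncSafe A p := by
  refine ⟨fun x _ => ⟨Fin.forall_fin_two.2 ⟨safe_var _, safe_childT (safe_var _) (safe_var _)
    (safe_var _)⟩, safe_countBody _ _ _⟩, fun x y b hx hy => ?_⟩
  obtain ⟨a, ha, ha'⟩ := hA.hasVal_countRule δ σ p hx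
  obtain ⟨a', hb, hb'⟩ := hA.hasVal_countRule δ σ p hy
  exact ha.trans ((congrArg some (Fin.ext (ha'.trans hb'.symm))).trans hb.symm)

theorem Stores.step (hA : Stores A w) (c : ChangeInst (memberProblem dyckLanguage) n) :
    Stores (dyckProgram.step c A) ((memberProblem dyckLanguage).change c.1 c.2 w) := by
  obtain ⟨δ, p⟩ := c
  change Fin 1 → Fin n at p
  change WordChange DyckStep at δ
  refine (change_eq_update δ p w).symm ▸ ?_
  set w' := Function.update w (p 0) (newLetter δ (w (p 0))) with hw'
  refine ⟨fun σ b => newRel_letterRule δ σ p hA b, fun f v b hd hc => ?_, fun v hz hs => ?_,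
    fun σ v hz hs => ?_⟩
  · rw [← hA.static_spec f v b hd hc]
    cases f with
    | count σ => exact absurd rfl (hc σ)
    | depth => exact absurd rfl hd
    | _ => exact Iff.of_eq (congrArg (· = some b) (congrFun (newFunc_staticRule p _) v))
  · change ∃ b, (depthRule δ).newFunc A p (A.func .depth) v = some b ∧ _
    by_cases h : blockStart (v 0) (p 0) = v 1
    · have hx : (depthRule δ).Addresses A p ![v 0] v :=
        (hA.addresses_depthRule_iff δ p _ _).2 ⟨hz, rfl, h⟩
      rw [newFunc_eq_of_addresses p (hA.funcSafe_depthRule δ p) hx, ← h]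
      have := hA.hasVal_depthBody δ (p 0) (v 0) hz
      have he : Fin.append p ![v 0] = ![p 0, v 0] := append_one_one p _
      rw [← he] at this
      exact this
    · rw [newFunc_eq_of_not_addresses, depth_eq_of_ne (height_update _ _) (v 1).2 hs (.inl h)]
      · exact hA.depth_spec v hz hs
      · rintro ⟨x, hx⟩
        obtain ⟨-, h₁, h₂⟩ := (hA.addresses_depthRule_iff δ p x v).1 hx
        exact h (h₁ ▸ h₂)
  · change ∃ b, (countRule δ σ).newFunc A p (A.func (.count σ)) v = some b ∧ _
    by_cases h : blockStart (v 0 + 1) (v 1) = blockStart (v 0 + 1) (p 0)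
    · obtain ⟨i, hi, hch⟩ := exists_isChild_iff.2 ⟨hs, h⟩
      have hn : 0 < n := (Nat.zero_le _).trans_lt (v 0).2
      have htop := top_lt hn
      have hx : (countRule δ σ).Addresses A p ![v 0, ⟨i, by omega⟩] v :=
        (hA.addresses_countRule_iff δ σ p _ _).2 ⟨⟨hz.le, hi.trans hz⟩, rfl, hz, hch⟩
      rw [newFunc_eq_of_addresses p (hA.funcSafe_countRule δ σ p) hx]
      exact hA.hasVal_countRule δ σ p hx
    · rw [newFunc_eq_of_not_addresses]
      · obtain ⟨b, hb, he⟩ := hA.count_spec σ v hz hs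
        refine ⟨b, hb, he.trans ?_⟩
        have h₁ := count_update w (p 0) (newLetter δ (w (p 0))) σ (v 1)
        have h₂ := count_update w (p 0) (newLetter δ (w (p 0))) σ (blockStart (v 0 + 1) (v 1))
        have hle := blockStart_le (v 0 + 1) (v 1)
        rw [← hw'] at h₁ h₂
        by_cases hp : (p 0 : ℕ) ≤ v 1
        · have hp' : (p 0 : ℕ) ≤ blockStart (v 0 + 1) (v 1) := by
            by_contra hlt
            refine h (le_antisymm ?_ (blockStart_mono _ hp))
            have := blockStart_mono (v 0 + 1) (not_le.1 hlt).le
            rwa [blockStart_blockStart] at this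
          rw [if_pos hp] at h₁
          rw [if_pos hp'] at h₂
          omega
        · rw [if_neg hp] at h₁
          rw [if_neg (by omega)] at h₂
          omega
      · rintro ⟨x, hx⟩
        obtain ⟨-, h₁, -, h₂⟩ := (hA.addresses_countRule_iff δ σ p x v).1 hx
        exact h (h₁ ▸ h₂.2)

theorem stores_initStr (n : ℕ) : Stores (dyckProgram.initStr n) (fun _ : Fin n => none) := by
  have hfunc : ∀ f v b, (dyckProgram.initStr n).func f v = some b ↔
      initGraph n f (Sum.elim v fun _ => b) := by
    intro f v b
    have hspec := (definable_initGraph f).choose_spec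
    refine (the?_eq_some_iff fun a b ha hb => ?_).trans (hspec n _)
    exact initGraph_unique ((hspec n _).1 ha) ((hspec n _).1 hb)
  have hcount : ∀ σ q, count (fun _ : Fin n => none) σ q = 0 := by
    intro σ q
    exact Nat.count_of_forall_not fun r _ => by simp [letter]
  have hheight : height (fun _ : Fin n => none) = fun _ => 0 := by
    funext q
    simp [height, hcount]
  refine ⟨fun σ v => ?_, fun f v b _ _ => hfunc f v b, fun v hz hs => ?_, fun σ v hz hs => ?_⟩
  · simp only [reduceCtorEq, iff_false]
    exact id
  · refine ⟨⟨0, (Nat.zero_le _).trans_lt (v 0).2⟩, (hfunc .depth v _).2 rfl, ?_⟩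
    rw [hheight, depth, blockMin_eq (v 1).2 rfl fun _ _ _ => le_rfl]
    rfl
  · refine ⟨⟨0, (Nat.zero_le _).trans_lt (v 0).2⟩, (hfunc (.count σ) v _).2 rfl, ?_⟩
    rw [hcount, hcount]

theorem stores_run (n : ℕ) (α : List (ChangeInst (memberProblem dyckLanguage) n)) :
    Stores (dyckProgram.run n α) ((memberProblem dyckLanguage).run n α) := by
  induction α using List.reverseRecOn with
  | nil => exact stores_initStr n
  | append_singleton α c ih =>
    rw [DynProgram.run, DynProblem.run, List.foldl_append, List.foldl_append]
    exact ih.step c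

theorem maintains_dyckProgram : dyckProgram.Maintains := by
  intro n hn α
  have hA := stores_run n α
  refine ⟨fun ⟨δ, p⟩ => ⟨fun σ => relSafe_letterRule δ σ p, fun f => ?_⟩, fun _ b =>
    ⟨safe_queryC b, hA.holds_queryC_iff b hn⟩⟩
  cases f with
  | count σ => exact hA.funcSafe_countRule δ σ p
  | depth => exact hA.funcSafe_depthRule δ p
  | _ => exact funcSafe_staticRule p _

end Maintenance

/-! ### Work -/

section Work

variable {k : ℕ} (n : ℕ) (s t u : Term dyckSchema k)

theorem work_countT (σ : DyckStep) : (countT σ s t).work n = 1 + (s.work n + t.work n) := by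
  simp only [countT, Term.work]
  exact congrArg _ (Fin.sum_univ_two _)

theorem work_depthT : (depthT s t).work n = 1 + (s.work n + t.work n) := by
  simp only [depthT, Term.work]
  exact congrArg _ (Fin.sum_univ_two _)

theorem work_startT : (startT s t).work n = 1 + (s.work n + t.work n) := by
  simp only [startT, Term.work]
  exact congrArg _ (Fin.sum_univ_two _)

theorem work_childT : (childT s t u).work n = 1 + (s.work n + t.work n + u.work n) := by
  simp only [childT, Term.work]
  exact congrArg _ (Fin.sum_univ_three _)

theorem work_succT : (succT s).work n = 1 + s.work n := by
  simp only [succT, Term.work]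
  exact congrArg _ (Fin.sum_univ_one _)

theorem work_predT : (predT s).work n = 1 + s.work n := by
  simp only [predT, Term.work]
  exact congrArg _ (Fin.sum_univ_one _)

theorem work_lastT : (lastT : Term dyckSchema k).work n = 1 := by
  simp only [lastT, Term.work]
  exact congrArg _ (Fin.sum_univ_zero _)

theorem work_topT : (topT : Term dyckSchema k).work n = 1 := by
  simp only [topT, Term.work]
  exact congrArg _ (Fin.sum_univ_zero _)

theorem work_letterC (σ : DyckStep) : (letterC σ s).work n = 1 + s.work n := by
  simp only [letterC, Cond.work]
  exact congrArg _ (Fin.sum_univ_one _)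

theorem work_addsC_le (δ : WordChange DyckStep) (σ : DyckStep) :
    (addsC δ σ s).work n ≤ 4 + 2 * s.work n := by
  unfold addsC
  split
  · split
    · simp only [Cond.work, work_letterC]
      omega
    · simp only [falseC, Cond.work, Term.work]
      omega
  · simp only [falseC, Cond.work, Term.work]
    omega

theorem work_removesC_le (δ : WordChange DyckStep) (σ : DyckStep) :
    (removesC δ σ s).work n ≤ 4 + s.work n := by
  unfold removesC
  split
  · simp only [falseC, Cond.work, Term.work]
    omega
  · rw [work_letterC]
    omega

/-- The searches over children and over the path stand side by side inside the search over y, so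
only two searches are ever nested. -/
theorem work_attainC_le {c : Cond dyckSchema 4} (hc : c.work n ≤ 20) :
    (attainC c).work n ≤ 200 * (top n + 1) ^ 2 := by
  have h : 1 ≤ top n + 1 := by omega
  simp only [attainC, ltC, lowC, Cond.work, Term.work, work_countT, work_depthT, work_startT,
    work_childT, work_succT, levels]
  generalize top n + 1 = x at h
  have hxc : x * (x * c.work n) ≤ x * (x * 20) := by gcongr
  have hx : x ≤ x * x := Nat.le_mul_of_pos_left x h
  ring_nf at hxc hx ⊢
  omega

theorem work_attainLtC_le : attainLtC.work n ≤ 200 * (top n + 1) ^ 2 := by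
  refine work_attainC_le n ?_
  simp only [ltC, Cond.work, Term.work, work_childT, work_startT]
  omega

theorem work_attainGeC_le : attainGeC.work n ≤ 200 * (top n + 1) ^ 2 := by
  refine work_attainC_le n ?_
  simp only [Cond.work, Term.work, work_childT]
  omega

/-- Each level needs two attainment tests of quadratic cost; everything else in the body is
constant. -/
theorem work_depthRule_le (δ : WordChange DyckStep) :
    (depthRule δ).work ((depthRule δ).body.work n) n ≤ 1000 * (top n + 1) ^ 3 := by
  have h : 1 ≤ top n + 1 := by omega
  have h₁ := work_attainLtC_le n
  have h₂ := work_attainGeC_le n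
  have ha := fun σ => work_addsC_le n (.var 0 : Term dyckSchema 2) δ σ
  have hr := fun σ => work_removesC_le n (.var 0 : Term dyckSchema 2) δ σ
  have h₃ := ha .U
  have h₄ := ha .D
  have h₅ := hr .U
  have h₆ := hr .D
  have hbody : (depthBody δ).work n ≤ 900 * (top n + 1) ^ 2 := by
    simp only [depthBody, Cond.work, Term.work, work_depthT, work_startT, work_succT,
      work_predT] at *
    have : 1 ≤ (top n + 1) ^ 2 := Nat.one_le_pow _ _ h
    omega
  have ht : ∑ i, ((depthRule δ).target i).work n = 4 := by
    refine (Fin.sum_univ_two _).trans ?_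
    simp [depthRule, Term.work, work_startT]
  have hp : ∏ i, (((depthRule δ).bound i).toFun n + 1) = top n + 1 := Fin.prod_univ_one _
  rw [UpdateRule.work, ht, hp]
  calc (top n + 1) * (1 + 4 + (depthBody δ).work n)
      ≤ (top n + 1) * (5 * (top n + 1) ^ 2 + 900 * (top n + 1) ^ 2) := by
        gcongr
        have : 1 ≤ (top n + 1) ^ 2 := Nat.one_le_pow _ _ h
        omega
    _ ≤ 1000 * (top n + 1) ^ 3 := by
        ring_nf
        omega

/-- Only constant work is done for each pair of a level and a child index, so the true cost is
quadratic. -/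
theorem work_countRule_le (δ : WordChange DyckStep) (σ : DyckStep) :
    (countRule δ σ).work ((countRule δ σ).body.work n) n ≤ 1000 * (top n + 1) ^ 3 := by
  have h : 1 ≤ top n + 1 := by omega
  have h₁ := work_addsC_le n (.var 0 : Term dyckSchema 3) δ σ
  have h₂ := work_removesC_le n (.var 0 : Term dyckSchema 3) δ σ
  have hbody : (countBody δ σ).work n ≤ 900 := by
    simp only [countBody, Cond.work, Term.work, work_countT, work_childT, work_startT, work_succT,
      work_predT] at *
    omega
  have ht : ∑ i, ((countRule δ σ).target i).work n = 5 := by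
    refine (Fin.sum_univ_two _).trans ?_
    simp [countRule, Term.work, work_childT]
  have hp : ∏ i, (((countRule δ σ).bound i).toFun n + 1) = (top n + 1) * (top n + 1) :=
    Fin.prod_univ_two _
  rw [UpdateRule.work, ht, hp]
  calc (top n + 1) * (top n + 1) * (1 + 5 + (countBody δ σ).work n)
      ≤ (top n + 1) * (top n + 1) * (1000 * (top n + 1)) := by
        gcongr
        omega
    _ = 1000 * (top n + 1) ^ 3 := by ring

theorem work_staticRule_le (f : DyckFunc) :
    (staticRule f).work ((staticRule f).body.work n) n ≤ 1000 * (top n + 1) ^ 3 := by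
  have h : 1 ≤ (top n + 1) ^ 3 := Nat.one_le_pow _ _ (by omega)
  have hp : ∏ i, (((staticRule f).bound i).toFun n + 1) = 1 := Fin.prod_univ_zero _
  rw [UpdateRule.work, hp]
  simp only [staticRule, Term.work, Finset.sum_const, Finset.card_univ, Fintype.card_fin]
  cases f <;> simp only [smul_eq_mul, mul_one] <;> omega

theorem work_letterRule_le (δ : WordChange DyckStep) (σ : DyckStep) :
    (letterRule δ σ).work ((letterRule δ σ).body.work n) n ≤ 1000 * (top n + 1) ^ 3 := by
  have h : 1 ≤ (top n + 1) ^ 3 := Nat.one_le_pow _ _ (by omega)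
  have hp : ∏ i, (((letterRule δ σ).bound i).toFun n + 1) = 1 := Fin.prod_univ_zero _
  have ht : ∑ i, ((letterRule δ σ).target i).work n = 1 := by
    refine (Fin.sum_univ_one _).trans ?_
    simp [letterRule, Term.work]
  have h₁ := work_addsC_le n (.var 0 : Term dyckSchema (1 + 0)) δ σ
  have h₂ := work_removesC_le n (.var 0 : Term dyckSchema (1 + 0)) δ σ
  rw [UpdateRule.work, hp, ht]
  simp only [letterRule, Cond.work, Term.work, work_letterC] at *
  omega

theorem work_queryC_le : queryC.work n ≤ 1000 * (top n + 1) ^ 3 := by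
  have h : 1 ≤ top n + 1 := by omega
  simp only [queryC, ltC, lowC, Cond.work, Term.work, work_countT, work_depthT, work_startT,
    work_succT, work_lastT, work_topT, work_letterC, levels]
  generalize top n + 1 = x at h
  have hx : x ≤ x ^ 3 := Nat.le_self_pow (by norm_num) x
  omega

end Work

theorem isBigO_log_of_le {f : ℕ → ℕ} (hf : ∀ n, f n ≤ 1000 * (top n + 1) ^ 3) :
    (fun n : ℕ => (f n : ℝ)) =O[Filter.atTop] fun n : ℕ => Real.log (n : ℝ) ^ 3 := by
  refine Asymptotics.IsBigO.trans (.of_bound 1000 (.of_forall fun n => ?_)) (top_isBigO_log.pow 3)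
  rw [Real.norm_of_nonneg (by positivity), Real.norm_of_nonneg (by positivity)]
  exact_mod_cast hf n

theorem changeWork_isBigO (δ : WordChange DyckStep) :
    (fun n : ℕ => (dyckProgram.changeWork δ n : ℝ)) =O[Filter.atTop]
      fun n : ℕ => Real.log (n : ℝ) ^ 3 := by
  simp only [DynProgram.changeWork, Nat.cast_add, Nat.cast_sum]
  refine .add (.fun_sum fun σ _ => isBigO_log_of_le fun n => work_letterRule_le n δ σ)
    (.fun_sum fun f _ => isBigO_log_of_le fun n => ?_)
  cases f with
  | count σ => exact work_countRule_le n δ σ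
  | depth => exact work_depthRule_le n δ
  | _ => exact work_staticRule_le n _

end DynFO

theorem mainTheorem6 :
    ∃ P : DynFO.DynProgram (DynFO.memberProblem DynFO.dyckLanguage),
      P.Maintains ∧
      (∀ δ, (fun n : ℕ => (P.changeWork δ n : ℝ)) =O[Filter.atTop]
        fun n : ℕ => Real.log (n : ℝ) ^ 3) ∧
      (∀ q, (fun n : ℕ => (P.queryWork q n : ℝ)) =O[Filter.atTop]
        fun n : ℕ => Real.log (n : ℝ) ^ 3) :=
  ⟨DynFO.dyckProgram, DynFO.maintains_dyckProgram, DynFO.changeWork_isBigO,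
    fun _ => DynFO.isBigO_log_of_le DynFO.work_queryC_le⟩
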